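/- Conventions. A conflation category is an additive category with a chosen class, closed under isomorphisms, of kernel-cokernel pairs $X\xrightarrow{f}Y\xrightarrow{g}Z$ (that is, $f=\ker g$ and $g=\operatorname{coker} f$), called conflations; then $f$ is called an inflation and $g$ a deflation. It is right exact if (R0) $1_0\colon 0\to 0$ is a deflation, (R1) deflations are closed under composition, and (R2) the pullback of a deflation along any morphism exists and is a deflation; left exact is the dual notion; exact means right and left exact (this is exactness in the sense of Quillen). Axiom R0$^*$: $A\to 0$ is a deflation for every object $A$. Axiom R3: if $i\colon A\to B$ and $p\colon B\to C$ are morphisms such that $p$ has a kernel and $pi$ is a deflation, then $p$ is a deflation. An additive functor between conflation categories is exact if it maps conflations to conflations. Let $\mathcal E$ be a right exact category. A complex $X^\bullet$ over $\mathcal E$ is acyclic if for every $n$ the differential $d^{n-1}\colon X^{n-1}\to X^n$ factors as a deflation that is a cokernel of $d^{n-2}$ followed by an inflation that is a kernel of $d^n$. Let $\mathbf D(\mathcal E)$ be the Verdier quotient of the homotopy category $\mathbf K(\mathcal E)$ by the triangulated subcategory of acyclic complexes, let $\mathbf D^b(\mathcal E)$ be the full (isomorphism-closed) triangulated subcategory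 of $\mathbf D(\mathcal E)$ spanned by the bounded complexes, let $i\colon\mathcal E\to\mathbf D^b(\mathcal E)$ send an object to the corresponding stalk complex in degree $0$, and let $i(\mathcal E)$ denote the essential image of $i$, viewed as a full subcategory. A full subcategory of a triangulated category is extension-closed if, for each triangle $A\to B\to C\to\Sigma A$ with $A$ and $C$ in it, $B$ is in it. (I) The following are equivalent: (a) $\mathcal E$ satisfies axiom R3; (b) a sequence $X\xrightarrow{f}Y\xrightarrow{g}Z$ in $\mathcal E$ is a conflation if and only if there is a triangle $i(X)\xrightarrow{i(f)}i(Y)\xrightarrow{i(g)}i(Z)\to\Sigma i(X)$ in $\mathbf D^b(\mathcal E)$. (II) Assume that $\mathcal E$ satisfies axiom R0$^*$. (1) If $\mathcal E$ is exact, then $i(\mathcal E)$ is extension-closed in $\mathbf D^b(\mathcal E)$. (2) If $i(\mathcal E)$ is extension-closed in $\mathbf D^b(\mathcal E)$, then the sequences $X\to Y\to Z$ in $i(\mathcal E)$ that occur in a triangle $X\to Y\to Z\to\Sigma X$ of $\mathbf D^b(\mathcal E)$ are the conflations of an exact structure on $i(\mathcal E)$, and the functor $\mathcal E\to i(\mathcal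 E)$ induced by $i$ is exact for this structure. If, in addition, $\mathcal E$ satisfies axiom R3, then the right exact category $\mathcal E$ is itself exact. -/

import Mathlib

open CategoryTheory CategoryTheory.Limits CategoryTheory.Pretriangulated
open scoped ZeroObject

universe v u v' u'

namespace RightExactCategory

section Conflations

/-- A class of kernel-cokernel pairs (the *conflations*), closed under isomorphisms.
A conflation category is an additive category together with such a class. -/
structure ConflationStructure (C : Type u) [Category.{v} C] [Preadditive C]
    [HasZeroObject C] [HasBinaryBiproducts C] where
  /-- `X ⟶ Y ⟶ Z` is a conflation. -/
  IsConflation : ∀ {X Y Z : C}, (X ⟶ Y) → (Y ⟶ Z) → Prop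
  zero : ∀ {X Y Z : C} {f : X ⟶ Y} {g : Y ⟶ Z}, IsConflation f g → f ≫ g = 0
  isKernel : ∀ {X Y Z : C} {f : X ⟶ Y} {g : Y ⟶ Z} (h : IsConflation f g),
    Nonempty (IsLimit (KernelFork.ofι f (zero h)))
  isCokernel : ∀ {X Y Z : C} {f : X ⟶ Y} {g : Y ⟶ Z} (h : IsConflation f g),
    Nonempty (IsColimit (CokernelCofork.ofπ g (zero h)))
  of_iso : ∀ {X Y Z X' Y' Z' : C} {f : X ⟶ Y} {g : Y ⟶ Z} {f' : X' ⟶ Y'} {g' : Y' ⟶ Z'}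
    (a : X ≅ X') (b : Y ≅ Y') (c : Z ≅ Z'),
    f ≫ b.hom = a.hom ≫ f' → g ≫ c.hom = b.hom ≫ g' → IsConflation f g → IsConflation f' g'

/-- An additive functor between conflation categories is exact if it maps conflations to
conflations. -/
structure IsExactFunctor {C : Type u} [Category.{v} C] [Preadditive C]
    [HasZeroObject C] [HasBinaryBiproducts C]
    {D : Type u'} [Category.{v'} D] [Preadditive D] [HasZeroObject D] [HasBinaryBiproducts D]
    (S : ConflationStructure C) (T : ConflationStructure D) (F : C ⥤ D) : Prop where
  additive : F.Additive
  map_conflation : ∀ {X Y Z : C} {f : X ⟶ Y} {g : Y ⟶ Z},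
    S.IsConflation f g → T.IsConflation (F.map f) (F.map g)

namespace ConflationStructure

variable {C : Type u} [Category.{v} C] [Preadditive C] [HasZeroObject C]
  [HasBinaryBiproducts C]

section

variable (S : ConflationStructure C)

/-- An inflation is the first morphism of a conflation. -/
def Inflation {X Y : C} (f : X ⟶ Y) : Prop := ∃ (Z : C) (g : Y ⟶ Z), S.IsConflation f g

/-- A deflation is the second morphism of a conflation. -/
def Deflation {Y Z : C} (g : Y ⟶ Z) : Prop := ∃ (X : C) (f : X ⟶ Y), S.IsConflation f g

/-- Right exact (deflation-exact) conflation categories: axioms **R0**, **R1**, **R2**. -/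
class IsRightExact : Prop where
  r0 : S.Deflation (𝟙 (0 : C))
  r1 : ∀ {X Y Z : C} (f : X ⟶ Y) (g : Y ⟶ Z),
    S.Deflation f → S.Deflation g → S.Deflation (f ≫ g)
  r2 : ∀ {Y Z W : C} (g : Y ⟶ W) (f : Z ⟶ W), S.Deflation g →
    ∃ (X : C) (f' : X ⟶ Y) (g' : X ⟶ Z), IsPullback f' g' g f ∧ S.Deflation g'

/-- Left exact (inflation-exact) conflation categories: axioms **L0**, **L1**, **L2**. -/
class IsLeftExact : Prop where
  l0 : S.Inflation (𝟙 (0 : C))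
  l1 : ∀ {X Y Z : C} (f : X ⟶ Y) (g : Y ⟶ Z),
    S.Inflation f → S.Inflation g → S.Inflation (f ≫ g)
  l2 : ∀ {X Y Z : C} (f : X ⟶ Y) (g : X ⟶ Z), S.Inflation f →
    ∃ (W : C) (g' : Y ⟶ W) (f' : Z ⟶ W), IsPushout f g g' f' ∧ S.Inflation f'

/-- Exact categories in the sense of Quillen. -/
def IsExact : Prop := S.IsRightExact ∧ S.IsLeftExact

/-- Axiom **R0***: every morphism `A ⟶ 0` is a deflation. -/
def R0star : Prop := ∀ A : C, S.Deflation (0 : A ⟶ (0 : C))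

/-- Axiom **R3**: if `p` has a kernel and `i ≫ p` is a deflation, then `p` is a deflation. -/
def R3 : Prop := ∀ {A B D : C} (i : A ⟶ B) (p : B ⟶ D),
  HasKernel p → S.Deflation (i ≫ p) → S.Deflation p

end

variable {S : ConflationStructure C}

lemma IsConflation.mono {X Y Z : C} {f : X ⟶ Y} {g : Y ⟶ Z} (h : S.IsConflation f g) :
    Mono f :=
  mono_of_isLimit_fork (S.isKernel h).some

lemma IsConflation.epi {X Y Z : C} {f : X ⟶ Y} {g : Y ⟶ Z} (h : S.IsConflation f g) :
    Epi g :=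
  epi_of_isColimit_cofork (S.isCokernel h).some

lemma IsConflation.exists_lift {X Y Z W : C} {f : X ⟶ Y} {g : Y ⟶ Z} (h : S.IsConflation f g)
    (k : W ⟶ Y) (hk : k ≫ g = 0) : ∃ l : W ⟶ X, l ≫ f = k :=
  ⟨(KernelFork.IsLimit.lift' (S.isKernel h).some k hk).1,
    (KernelFork.IsLimit.lift' (S.isKernel h).some k hk).2⟩

lemma IsConflation.exists_desc {X Y Z W : C} {f : X ⟶ Y} {g : Y ⟶ Z} (h : S.IsConflation f g)
    (k : Y ⟶ W) (hk : f ≫ k = 0) : ∃ l : Z ⟶ W, g ≫ l = k :=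
  ⟨(CokernelCofork.IsColimit.desc' (S.isCokernel h).some k hk).1,
    (CokernelCofork.IsColimit.desc' (S.isCokernel h).some k hk).2⟩

/-- A deflation together with any kernel of it is a conflation. -/
lemma Deflation.isConflation {X Y Z : C} {f : X ⟶ Y} {g : Y ⟶ Z} (hg : S.Deflation g)
    (w : f ≫ g = 0) (hf : ∀ {W : C} (k : W ⟶ Y), k ≫ g = 0 → ∃ l : W ⟶ X, l ≫ f = k)
    [Mono f] : S.IsConflation f g := by
  obtain ⟨X', f', h⟩ := hg
  have := h.mono
  obtain ⟨a, ha⟩ := hf f' (S.zero h)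
  obtain ⟨b, hb⟩ := h.exists_lift f w
  refine S.of_iso ⟨a, b, ?_, ?_⟩ (Iso.refl _) (Iso.refl _) (by simp [ha]) (by simp) h
  · rw [← cancel_mono f', Category.assoc, hb, ha, Category.id_comp]
  · rw [← cancel_mono f, Category.assoc, ha, hb, Category.id_comp]

/-- A pullback of a deflation is a deflation. -/
lemma Deflation.of_isPullback [S.IsRightExact] {X Y Z W : C} {f' : X ⟶ Y}
    {g' : X ⟶ Z} {g : Y ⟶ W} {f : Z ⟶ W} (h : IsPullback f' g' g f) (hg : S.Deflation g) :
    S.Deflation g' := by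
  obtain ⟨X', f'', g'', h', ⟨K, k, hk⟩⟩ := IsRightExact.r2 g f hg
  exact ⟨K, k ≫ (h'.isoIsPullback _ _ h).hom,
    S.of_iso (Iso.refl _) (h'.isoIsPullback _ _ h) (Iso.refl _) (by simp) (by simp) hk⟩

end ConflationStructure

end Conflations

section Acyclic

variable {E : Type u} [Category.{v} E] [Preadditive E] [HasZeroObject E] [HasBinaryBiproducts E]
  (S : ConflationStructure E)

/-- The complex `K` is acyclic in degree `n`: the differential `K.X (n - 1) ⟶ K.X n` factors as a
deflation which is a cokernel of the previous differential followed by an inflation which is a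
kernel of the next differential. -/
def IsAcyclicInDegree (K : CochainComplex E ℤ) (n : ℤ) : Prop :=
  ∃ (Z : E) (p : K.X (n - 1) ⟶ Z) (i : Z ⟶ K.X n),
    p ≫ i = K.d (n - 1) n ∧ S.Deflation p ∧ S.Inflation i ∧
    (∃ w : K.d (n - 2) (n - 1) ≫ p = 0, Nonempty (IsColimit (CokernelCofork.ofπ p w))) ∧
    (∃ w : i ≫ K.d n (n + 1) = 0, Nonempty (IsLimit (KernelFork.ofι i w)))

/-- A complex is acyclic if it is acyclic in each degree. -/
def IsAcyclic (K : CochainComplex E ℤ) : Prop := ∀ n : ℤ, IsAcyclicInDegree S K n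

/-- A complex is acyclic if and only if it is obtained by splicing conflations. -/
lemma isAcyclic_iff (K : CochainComplex E ℤ) : IsAcyclic S K ↔
    ∃ (Z : ℤ → E) (ι : ∀ n, Z n ⟶ K.X n) (π : ∀ j n, j + 1 = n → (K.X j ⟶ Z n)),
      (∀ j n h, S.IsConflation (ι j) (π j n h)) ∧ ∀ j n h, π j n h ≫ ι n = K.d j n := by
  constructor
  · intro hK
    have : ∀ n, ∃ (Z : E) (i : Z ⟶ K.X n), ∀ j, j + 1 = n → ∃ p : K.X j ⟶ Z,
        p ≫ i = K.d j n ∧ S.Deflation p ∧ S.Inflation i ∧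
        ∀ l, n + 1 = l → ∃ w : i ≫ K.d n l = 0, Nonempty (IsLimit (KernelFork.ofι i w)) := by
      intro n
      obtain ⟨Z, p, i, h₁, h₂, h₃, -, h₅⟩ := hK n
      refine ⟨Z, i, fun j hj => ?_⟩
      obtain rfl : j = n - 1 := by lia
      exact ⟨p, h₁, h₂, h₃, by rintro _ rfl; exact h₅⟩
    choose Z ι hZ using this
    choose! π hπ using hZ
    refine ⟨Z, ι, fun j n _ => π n j, fun j n h => ?_, fun j n h => (hπ n j h).1⟩
    obtain ⟨h₁, h₂, ⟨_, _, hi⟩, -⟩ := hπ n j h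
    obtain ⟨-, -, -, h₅⟩ := hπ j (j - 1) (by lia)
    obtain ⟨w, ⟨hw⟩⟩ := h₅ n h
    have := hi.mono
    have : Mono (ι j) := mono_of_isLimit_fork hw
    refine h₂.isConflation ?_ ?_
    · rw [← cancel_mono (ι n), Category.assoc, h₁, w, zero_comp]
    · intro W k hk
      exact ⟨(KernelFork.IsLimit.lift' hw k (by rw [← h₁, reassoc_of% hk, zero_comp])).1,
        (KernelFork.IsLimit.lift' hw k (by rw [← h₁, reassoc_of% hk, zero_comp])).2⟩
  · rintro ⟨Z, ι, π, hc, hd⟩ n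
    have h₁ := hc (n - 1) n (by lia)
    have h₂ := hc n (n + 1) rfl
    have := (hc (n + 1) (n + 1 + 1) rfl).mono
    have := (hc (n - 2) (n - 1) (by lia)).epi
    have := h₁.epi
    have := h₂.mono
    have w₁ : K.d (n - 2) (n - 1) ≫ π (n - 1) n (by lia) = 0 := by
      rw [← hd (n - 2) (n - 1) (by lia), Category.assoc, S.zero h₁, comp_zero]
    have w₂ : ι n ≫ K.d n (n + 1) = 0 := by
      rw [← hd n (n + 1) rfl, reassoc_of% (S.zero h₂), zero_comp]
    refine ⟨Z n, π (n - 1) n (by lia), ι n, hd _ _ _, ⟨_, _, h₁⟩, ⟨_, _, h₂⟩,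
      ⟨w₁, ⟨?_⟩⟩, ⟨w₂, ⟨?_⟩⟩⟩
    · refine CokernelCofork.IsColimit.ofπ' _ _ fun k hk => Classical.indefiniteDescription _ ?_
      refine h₁.exists_desc k ?_
      have e : n - 2 + 1 = n - 1 := by lia
      rw [← cancel_epi (π (n - 2) (n - 1) e), ← Category.assoc, hd, hk]
      exact comp_zero.symm
    · refine KernelFork.IsLimit.ofι' _ _ fun k hk => Classical.indefiniteDescription _ ?_
      refine h₂.exists_lift k ?_
      rw [← cancel_mono (ι (n + 1)), Category.assoc, hd, hk, zero_comp]

end Acyclic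

section Cone

variable {E : Type u} [Category.{v} E] [Preadditive E] [HasZeroObject E] [HasBinaryBiproducts E]
  (S : ConflationStructure E) [S.IsRightExact]

open CochainComplex CochainComplex.HomComplex

/-- The mapping cone of a chain map between acyclic complexes is acyclic. -/
lemma isAcyclic_mappingCone {A B : CochainComplex E ℤ} (f : A ⟶ B)
    (hA : IsAcyclic S A) (hB : IsAcyclic S B) : IsAcyclic S (mappingCone f) := by
  rw [isAcyclic_iff] at hA hB ⊢
  obtain ⟨ZA, ιA, πA, hcA, hdA⟩ := hA
  obtain ⟨ZB, ιB, πB, hcB, hdB⟩ := hB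
  have monoA : ∀ n, Mono (ιA n) := fun n => (hcA n (n + 1) rfl).mono
  have monoB : ∀ n, Mono (ιB n) := fun n => (hcB n (n + 1) rfl).mono
  have epiA : ∀ j n h, Epi (πA j n h) := fun j n h => (hcA j n h).epi
  -- the induced maps on cycles
  have hg : ∀ n, ∃ g : ZA n ⟶ ZB n, g ≫ ιB n = ιA n ≫ f.f n := fun n =>
    (hcB n (n + 1) rfl).exists_lift _ (by
      rw [← cancel_mono (ιB (n + 1)), Category.assoc, Category.assoc, hdB, f.comm,
        ← hdA n (n + 1) rfl, Category.assoc, reassoc_of% (S.zero (hcA n (n + 1) rfl)),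
        zero_comp, zero_comp])
  choose g hg using hg
  have hg' : ∀ j n h, πA j n h ≫ g n = f.f j ≫ πB j n h := fun j n h => by
    rw [← cancel_mono (ιB n), Category.assoc, Category.assoc, hg, hdB, f.comm,
      ← hdA j n h, Category.assoc]
  have hP : ∀ n, ∃ (P : E) (v : P ⟶ B.X n) (u : P ⟶ ZA (n + 1)),
      IsPullback v u (πB n (n + 1) rfl) (g (n + 1)) := fun n => by
    obtain ⟨P, v, u, h, -⟩ := ConflationStructure.IsRightExact.r2 (S := S)
      (πB n (n + 1) rfl) (g (n + 1)) ⟨_, _, hcB n (n + 1) rfl⟩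
    exact ⟨P, v, u, h⟩
  choose P v u hP using hP
  have hσ : ∀ n, ∃ σ : A.X n ⊞ ZB n ⟶ P n,
      σ ≫ v n = biprod.fst ≫ f.f n + biprod.snd ≫ ιB n ∧
      σ ≫ u n = biprod.fst ≫ πA n (n + 1) rfl := fun n =>
    ⟨(hP n).lift (biprod.fst ≫ f.f n + biprod.snd ≫ ιB n) (biprod.fst ≫ πA n (n + 1) rfl) (by
      rw [Preadditive.add_comp, Category.assoc, Category.assoc, Category.assoc,
        S.zero (hcB n (n + 1) rfl), hg', comp_zero, add_zero]), by simp, by simp⟩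
  choose σ hσv hσu using hσ
  have hσpb : ∀ n, IsPullback (biprod.fst : A.X n ⊞ ZB n ⟶ _) (σ n)
      (πA n (n + 1) rfl) (u n) := fun n =>
    { w := (hσu n).symm
      isLimit' := ⟨by
        refine PullbackCone.IsLimit.mk _ (fun s => biprod.lift s.fst
          ((hcB n (n + 1) rfl).exists_lift (s.snd ≫ v n - s.fst ≫ f.f n) (by
            rw [Preadditive.sub_comp, Category.assoc, Category.assoc, (hP n).w, ← hg',
              ← s.condition_assoc, sub_self])).choose) (fun s => by simp) (fun s => ?_)
          (fun s m h₁ h₂ => ?_)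
        · have hs := ((hcB n (n + 1) rfl).exists_lift (s.snd ≫ v n - s.fst ≫ f.f n) (by
            rw [Preadditive.sub_comp, Category.assoc, Category.assoc, (hP n).w, ← hg',
              ← s.condition_assoc, sub_self])).choose_spec
          apply (hP n).hom_ext
          · rw [Category.assoc, hσv, Preadditive.comp_add, biprod.lift_fst_assoc,
              biprod.lift_snd_assoc, hs]
            abel
          · rw [Category.assoc, hσu, biprod.lift_fst_assoc, s.condition]
        · have hs := ((hcB n (n + 1) rfl).exists_lift (s.snd ≫ v n - s.fst ≫ f.f n) (by
            rw [Preadditive.sub_comp, Category.assoc, Category.assoc, (hP n).w, ← hg',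
              ← s.condition_assoc, sub_self])).choose_spec
          apply biprod.hom_ext
          · rw [biprod.lift_fst, h₁]
          · rw [biprod.lift_snd, ← cancel_mono (ιB n), hs, ← h₁, ← h₂, Category.assoc,
              Category.assoc, Category.assoc, hσv]
            simp⟩ }
  have hσd : ∀ n, S.Deflation (σ n) := fun n =>
    ConflationStructure.Deflation.of_isPullback (hσpb n) ⟨_, _, hcA n (n + 1) rfl⟩
  let fs (j n : ℤ) (h : j + 1 = n) : (mappingCone f).X j ⟶ A.X n :=
    (mappingCone.fst f).1.v j n h
  let sn (j : ℤ) : (mappingCone f).X j ⟶ B.X j := (mappingCone.snd f).v j j (add_zero j)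
  let ρ (j n : ℤ) (h : j + 1 = n) : (mappingCone f).X j ⟶ A.X n ⊞ ZB n :=
    biprod.lift (fs j n h) (sn j ≫ πB j n h)
  have hρpb : ∀ j n h, IsPullback (sn j) (ρ j n h) (πB j n h)
      (biprod.snd : A.X n ⊞ ZB n ⟶ _) := fun j n h =>
    { w := by simp [ρ]
      isLimit' := ⟨by
        refine PullbackCone.IsLimit.mk _ (fun s =>
          (s.snd ≫ biprod.fst) ≫ (mappingCone.inl f).v n j (by lia) +
            s.fst ≫ (mappingCone.inr f).f j) (fun s => by simp [sn]) (fun s => ?_)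
          (fun s m h₁ h₂ => ?_)
        · apply biprod.hom_ext
          · simp [ρ, fs]
          · simp [ρ, sn, s.condition]
        · apply mappingCone.ext_to f j n h
          · simp [← h₂, ρ, fs]
          · simp [← h₁, sn]⟩ }
  have hρd : ∀ j n h, S.Deflation (ρ j n h) := fun j n h =>
    ConflationStructure.Deflation.of_isPullback (hρpb j n h) ⟨_, _, hcB j n h⟩
  have hτd : ∀ j n h, S.Deflation (-(ρ j n h ≫ σ n)) := fun j n h => by
    obtain ⟨K, k, hk⟩ := ConflationStructure.IsRightExact.r1 _ _ (hρd j n h) (hσd n)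
    exact ⟨K, k, S.of_iso (Iso.refl _) (Iso.refl _) ⟨-𝟙 _, -𝟙 _, by simp, by simp⟩
      (by simp) (by simp) hk⟩
  let ι (n : ℤ) : P n ⟶ (mappingCone f).X n :=
    (u n ≫ ιA (n + 1)) ≫ (mappingCone.inl f).v (n + 1) n (by lia) -
      v n ≫ (mappingCone.inr f).f n
  have hι₁ : ∀ n, ι n ≫ fs n (n + 1) rfl = u n ≫ ιA (n + 1) := fun n => by simp [ι, fs]
  have hι₂ : ∀ n, ι n ≫ sn n = - v n := fun n => by simp [ι, sn]
  have hτu : ∀ j n h, (ρ j n h ≫ σ n) ≫ u n = fs j n h ≫ πA n (n + 1) rfl := fun j n h => by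
    rw [Category.assoc, hσu, biprod.lift_fst_assoc]
  have hτv : ∀ j n h, (ρ j n h ≫ σ n) ≫ v n = fs j n h ≫ f.f n + sn j ≫ B.d j n :=
    fun j n h => by
      rw [Category.assoc, hσv, Preadditive.comp_add, biprod.lift_fst_assoc,
        biprod.lift_snd_assoc, Category.assoc, hdB]
  have hι : ∀ n, Mono (ι n) := fun n => ⟨fun a b hab => by
    apply (hP n).hom_ext
    · have := hab =≫ sn n
      simpa [hι₂] using this
    · have := hab =≫ fs n (n + 1) rfl
      rw [Category.assoc, Category.assoc, hι₁] at this
      simpa only [← Category.assoc, cancel_mono] using this⟩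
  refine ⟨P, ι, fun j n h => -(ρ j n h ≫ σ n), fun j n h => ?_, fun j n h => ?_⟩
  · subst h
    refine (hτd j _ rfl).isConflation ?_ ?_
    · rw [Preadditive.comp_neg, neg_eq_zero]
      apply (hP _).hom_ext
      · rw [zero_comp, Category.assoc, hτv, Preadditive.comp_add, reassoc_of% (hι₁ j),
          reassoc_of% (hι₂ j), ← hg, Preadditive.neg_comp, ← hdB j (j + 1) rfl,
          (hP j).w_assoc]
        simp
      · rw [zero_comp, Category.assoc, hτu, reassoc_of% (hι₁ j),
          S.zero (hcA _ _ rfl), comp_zero]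
    · intro W k hk
      rw [Preadditive.comp_neg, neg_eq_zero] at hk
      have h₁ : (k ≫ fs j (j + 1) rfl) ≫ πA (j + 1) (j + 1 + 1) rfl = 0 := by
        rw [Category.assoc, ← hτu, ← Category.assoc, hk, zero_comp]
      have h₂ : k ≫ fs j (j + 1) rfl ≫ f.f (j + 1) + k ≫ sn j ≫ B.d j (j + 1) = 0 := by
        rw [← Preadditive.comp_add, ← hτv, ← Category.assoc, hk, zero_comp]
      obtain ⟨z, hz⟩ := (hcA (j + 1) _ rfl).exists_lift _ h₁
      refine ⟨(hP j).lift (-(k ≫ sn j)) z ?_, ?_⟩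
      · rw [← cancel_mono (ιB (j + 1)), Category.assoc, Category.assoc, hdB, hg,
          reassoc_of% hz, Preadditive.neg_comp, Category.assoc]
        exact (eq_neg_of_add_eq_zero_left h₂).symm
      · apply mappingCone.ext_to f j (j + 1) rfl
        · change _ ≫ fs j (j + 1) rfl = _ ≫ fs j (j + 1) rfl
          rw [Category.assoc, hι₁, IsPullback.lift_snd_assoc, hz]
        · change _ ≫ sn j = _ ≫ sn j
          rw [Category.assoc, hι₂, Preadditive.comp_neg, IsPullback.lift_fst, neg_neg]
  · apply mappingCone.ext_to f n (n + 1) rfl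
    · change _ ≫ fs n (n + 1) rfl = _
      rw [Category.assoc, hι₁, Preadditive.neg_comp, ← Category.assoc, hτu, Category.assoc, hdA,
        mappingCone.d_fst_v f j n (n + 1) h rfl]
    · change _ ≫ sn n = _
      rw [Category.assoc, hι₂, Preadditive.neg_comp, Preadditive.comp_neg, neg_neg, hτv,
        mappingCone.d_snd_v f j n h]

end Cone

section DerivedCategory

variable {E : Type u} [Category.{v} E] [Preadditive E] [HasZeroObject E] [HasBinaryBiproducts E]
  (S : ConflationStructure E)

/-- The full subcategory of the homotopy category `K(E)` given by the acyclic complexes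
(not necessarily closed under isomorphisms). -/
def acyclicComplexes : ObjectProperty (HomotopyCategory E (ComplexShape.up ℤ)) :=
  fun K => IsAcyclic S K.as

lemma isAcyclic_shift {K : CochainComplex E ℤ} (hK : IsAcyclic S K) (n : ℤ) :
    IsAcyclic S (K⟦n⟧) := by
  rw [isAcyclic_iff] at hK ⊢
  obtain ⟨Z, ι, π, hc, hd⟩ := hK
  refine ⟨fun k => Z (k + n), fun k => ι (k + n),
    fun j k h => n.negOnePow • π (j + n) (k + n) (by lia), fun j k h => ?_, fun j k h => ?_⟩
  · have hk := hc (j + n) (k + n) (by lia)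
    refine S.of_iso (Iso.refl _) (Iso.refl _) (n.negOnePow • Iso.refl (Z (k + n)))
      (by simp) (by simp) hk
  · change (n.negOnePow • π (j + n) (k + n) _) ≫ ι (k + n) = n.negOnePow • K.d (j + n) (k + n)
    rw [Linear.units_smul_comp, hd]

lemma acyclicComplexes_le_shift (n : ℤ) :
    acyclicComplexes S ≤ (acyclicComplexes S).shift n := fun K hK => by
  obtain ⟨K, rfl⟩ := HomotopyCategory.quotient_obj_surjective K
  rw [ObjectProperty.prop_shift_iff, HomotopyCategory.shift_quotient_obj]
  exact isAcyclic_shift S (K := K) hK n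

instance [S.IsRightExact] : (acyclicComplexes S).IsTriangulated where
  exists_zero := by
    refine ⟨(HomotopyCategory.quotient _ _).obj 0, Functor.map_isZero _ (isZero_zero _), ?_⟩
    change IsAcyclic S 0
    rw [isAcyclic_iff]
    obtain ⟨K, k, hk⟩ := ConflationStructure.IsRightExact.r0 (S := S)
    have hK : IsZero K := by
      have := hk.mono
      exact IsZero.of_mono k (isZero_zero _)
    have h0 : ∀ n, IsZero ((0 : CochainComplex E ℤ).X n) := fun n =>
      Functor.map_isZero (HomologicalComplex.eval E (ComplexShape.up ℤ) n) (isZero_zero _)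
    exact ⟨fun _ => 0, fun _ => 0, fun _ _ _ => 0, fun j n h =>
      S.of_iso (hK.iso (isZero_zero _)) ((isZero_zero _).iso (h0 j)) (Iso.refl _)
        ((h0 j).eq_of_tgt _ _) ((isZero_zero _).eq_of_tgt _ _) hk,
      fun j n h => (h0 n).eq_of_tgt _ _⟩
  isStableUnderShiftBy n := { le_shift := acyclicComplexes_le_shift S n }
  ext₂' := by
    have : (acyclicComplexes S).IsStableUnderShift ℤ :=
      ⟨fun n => { le_shift := acyclicComplexes_le_shift S n }⟩
    have : (acyclicComplexes S).IsTriangulatedClosed₃ := ⟨fun T hT h₁ h₂ => by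
      obtain ⟨f, hf⟩ := (HomotopyCategory.quotient E (ComplexShape.up ℤ)).map_surjective
        (X := T.obj₁.as) (Y := T.obj₂.as) T.mor₁
      refine ⟨_, isAcyclic_mappingCone S f h₁ h₂,
        ⟨Triangle.π₃.mapIso (isoTriangleOfIso₁₂ T (CochainComplex.mappingCone.triangleh f) hT
          (HomotopyCategory.mappingCone_triangleh_distinguished f)
          (Iso.refl _) (Iso.refl _) ?_)⟩⟩
      exact (Category.comp_id _).trans (hf.symm.trans (Category.id_comp _).symm)⟩
    have := ObjectProperty.IsTriangulatedClosed₂.of_isTriangulatedClosed₃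
      (P := acyclicComplexes S)
    exact this.ext₂'

variable [S.IsRightExact]

/-- The (unbounded) derived category `D(E)`: the Verdier quotient of the homotopy category `K(E)`
by the acyclic complexes. -/
abbrev DerivedCat := (acyclicComplexes S).trW.Localization

/-- The canonical functor from cochain complexes to the derived category. -/
noncomputable abbrev toDerivedCat : CochainComplex E ℤ ⥤ DerivedCat S :=
  HomotopyCategory.quotient E (ComplexShape.up ℤ) ⋙ (acyclicComplexes S).trW.Q

/-- A cochain complex is bounded if it is zero in all but finitely many degrees. -/
def IsBoundedComplex (K : CochainComplex E ℤ) : Prop :=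
  ∃ a b : ℤ, ∀ n : ℤ, n < a ∨ b < n → IsZero (K.X n)

/-- The objects of the full triangulated subcategory of `D(E)` spanned by the bounded complexes:
those that lie in every isomorphism-closed triangulated subcategory of `D(E)` containing the
bounded complexes. -/
def boundedObjects : ObjectProperty (DerivedCat S) := fun X =>
  ∀ Q : ObjectProperty (DerivedCat S), Q.IsTriangulated → Q.IsClosedUnderIsomorphisms →
    (∀ K : CochainComplex E ℤ, IsBoundedComplex K → Q ((toDerivedCat S).obj K)) → Q X

instance : (boundedObjects S).IsClosedUnderIsomorphisms where
  of_iso e h Q h₁ h₂ h₃ := Q.prop_of_iso e (h Q h₁ h₂ h₃)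

instance : (boundedObjects S).IsTriangulated where
  exists_zero := ⟨0, isZero_zero _, fun Q _ _ _ => Q.prop_zero⟩
  isStableUnderShiftBy n :=
    { le_shift := fun _ hX Q h₁ h₂ h₃ => Q.le_shift n _ (hX Q h₁ h₂ h₃) }
  ext₂' T hT hX hY := ObjectProperty.le_isoClosure _ _ fun Q h₁ h₂ h₃ =>
    Q.ext_of_isTriangulatedClosed₂ T hT (hX Q h₁ h₂ h₃) (hY Q h₁ h₂ h₃)

/-- The bounded derived category `Dᵇ(E)`, with its structure of a triangulated category. -/
abbrev BoundedDerivedCat := (boundedObjects S).FullSubcategory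

lemma boundedObjects_single (X : E) : boundedObjects S
    ((HomologicalComplex.single E (ComplexShape.up ℤ) 0 ⋙ toDerivedCat S).obj X) :=
  fun _ _ _ h => h _ ⟨0, 0, fun _ hn =>
    HomologicalComplex.isZero_single_obj_X (ComplexShape.up ℤ) 0 X _ (by lia)⟩

/-- The canonical embedding `i : E ⥤ Dᵇ(E)`, sending an object to the corresponding stalk complex
in degree zero. -/
noncomputable def embedding : E ⥤ BoundedDerivedCat S :=
  (boundedObjects S).lift (HomologicalComplex.single E (ComplexShape.up ℤ) 0 ⋙ toDerivedCat S)
    (boundedObjects_single S)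

instance : (embedding S).Additive where
  map_add {X Y f g} := by
    ext
    exact (HomologicalComplex.single E (ComplexShape.up ℤ) 0 ⋙ toDerivedCat S).map_add

/-- The essential image `i(E)`, as a full subcategory of `Dᵇ(E)`. -/
abbrev Image := (embedding S).EssImageSubcategory

instance : HasZeroObject (Image S) := by
  have : (embedding S).essImage.ContainsZero :=
    ⟨⟨0, isZero_zero _, 0, ⟨(embedding S).mapZeroObject⟩⟩⟩
  infer_instance

instance : HasBinaryBiproducts (Image S) := by
  have : (embedding S).toEssImage.Additive := ⟨fun {_ _ _ _} => by
    ext : 1; exact (embedding S).map_add⟩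
  have := preservesBinaryBiproducts_of_preservesBiproducts (embedding S).toEssImage
  exact ⟨fun X Y => hasBinaryBiproduct_of_iso ((embedding S).toEssImage.objObjPreimageIso X)
    ((embedding S).toEssImage.objObjPreimageIso Y)⟩

/-- `X ⟶ Y ⟶ Z` is part of a (distinguished) triangle `X ⟶ Y ⟶ Z ⟶ ΣX`. -/
def IsTrianglePair {T : Type u'} [Category.{v'} T] [HasZeroObject T] [HasShift T ℤ]
    [Preadditive T] [∀ n : ℤ, (shiftFunctor T n).Additive] [Pretriangulated T]
    {X Y Z : T} (f : X ⟶ Y) (g : Y ⟶ Z) : Prop :=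
  ∃ h : Z ⟶ X⟦(1 : ℤ)⟧, Triangle.mk f g h ∈ distTriang T

/-- A full subcategory of a triangulated category is extension-closed if the middle term of every
triangle whose outer terms lie in it, lies in it. -/
def IsExtensionClosed {T : Type u'} [Category.{v'} T] [HasZeroObject T] [HasShift T ℤ]
    [Preadditive T] [∀ n : ℤ, (shiftFunctor T n).Additive] [Pretriangulated T]
    (P : ObjectProperty T) : Prop :=
  ∀ ⦃X Y Z : T⦄ (f : X ⟶ Y) (g : Y ⟶ Z), IsTrianglePair f g → P X → P Z → P Y

end DerivedCategory

end RightExactCategory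

/-! Everything about `embedding S` is drawn from two facts on morphisms in the derived category. The
first is effaceability (`isEffaceable_embedding`): any class `Z ⟶ ΣX` between stalks vanishes after
precomposition with some deflation onto `Z`. Up to a deflation, a morphism out of a stalk comes from
the homotopy category, where stalks in different degrees have no nonzero morphisms between them. The
second, under R0*, is that the embedding is nonnegative (`isNonnegativeEmbedding_embedding`): it is
fully faithful and there are no nonzero maps `ΣX ⟶ Y`. The vanishing rests on truncating an acyclic
complex in nonpositive degrees (`exists_acyclic_factorization`). Under R0* every conflation also
gives a triangle (`isTrianglePair_embedding`).

The rest is formal. For a nonnegative embedding, triangles with terms in the image are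
kernel-cokernel pairs, and an extension-closed image makes them an exact structure
(`IsNonnegativeEmbedding.isExact`). Under R3, a sequence giving a triangle is a conflation: a
deflation killing the connecting map lifts through the second morphism, which R3 then makes a
deflation. Conversely, if triangles detect conflations, the octahedral axiom applied to the pullback
of `i ≫ p` along `p` yields R3. If `E` is exact, a class `Z ⟶ ΣX` killed by a deflation is realised
by a pushout of the corresponding conflation, so the middle term of its triangle lies in `i(E)`. -/

namespace RightExactCategory

/-! ### Pullback and pushout criteria in preadditive categories. -/

section Squares

variable {A : Type u} [Category.{v} A] [Preadditive A] {P X Y Z : A}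

/-- Triangles yield lifts without uniqueness. By additivity, uniqueness reduces to a separate test
on zero maps. -/
lemma isPullback_of_exists_lift {a : P ⟶ X} {b : P ⟶ Y} {f : X ⟶ Z} {g : Y ⟶ Z}
    (w : a ≫ f = b ≫ g)
    (hl : ∀ {W : A} (x : W ⟶ X) (y : W ⟶ Y), x ≫ f = y ≫ g → ∃ l : W ⟶ P, l ≫ a = x ∧ l ≫ b = y)
    (hz : ∀ {W : A} (l : W ⟶ P), l ≫ a = 0 → l ≫ b = 0 → l = 0) : IsPullback a b f g := by
  choose l hl₁ hl₂ using @hl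
  exact ⟨⟨w⟩, ⟨PullbackCone.IsLimit.mk w (fun s => l s.fst s.snd s.condition)
    (fun s => hl₁ _ _ _) (fun s => hl₂ _ _ _) fun s m h₁ h₂ => sub_eq_zero.1 (hz _
      (by rw [Preadditive.sub_comp, h₁, hl₁, sub_self])
      (by rw [Preadditive.sub_comp, h₂, hl₂, sub_self]))⟩⟩

lemma isPushout_of_exists_desc {f : Z ⟶ X} {g : Z ⟶ Y} {a : X ⟶ P} {b : Y ⟶ P}
    (w : f ≫ a = g ≫ b)
    (hl : ∀ {W : A} (x : X ⟶ W) (y : Y ⟶ W), f ≫ x = g ≫ y → ∃ l : P ⟶ W, a ≫ l = x ∧ b ≫ l = y)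
    (hz : ∀ {W : A} (l : P ⟶ W), a ≫ l = 0 → b ≫ l = 0 → l = 0) : IsPushout f g a b := by
  choose l hl₁ hl₂ using @hl
  exact ⟨⟨w⟩, ⟨PushoutCocone.IsColimit.mk w (fun s => l s.inl s.inr s.condition)
    (fun s => hl₁ _ _ _) (fun s => hl₂ _ _ _) fun s m h₁ h₂ => sub_eq_zero.1 (hz _
      (by rw [Preadditive.comp_sub, h₁, hl₁, sub_self])
      (by rw [Preadditive.comp_sub, h₂, hl₂, sub_self]))⟩⟩

end Squares

/-! ### Exactness and completion properties of triangles. -/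

section TrianglePairs

variable {T : Type u'} [Category.{v'} T] [HasZeroObject T] [HasShift T ℤ]
    [Preadditive T] [∀ n : ℤ, (shiftFunctor T n).Additive] [Pretriangulated T]

/-- A triangle isomorphic to a distinguished triangle is distinguished. -/
lemma mk_mem_distTriang_of_iso {X Y Z X' Y' Z' : T} {f : X ⟶ Y} {g : Y ⟶ Z}
    {δ : Z ⟶ X⟦(1 : ℤ)⟧} {f' : X' ⟶ Y'} {g' : Y' ⟶ Z'} {δ' : Z' ⟶ X'⟦(1 : ℤ)⟧}
    (h : Triangle.mk f g δ ∈ distTriang T) (a : X ≅ X') (b : Y ≅ Y') (c : Z ≅ Z')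
    (h₁ : f ≫ b.hom = a.hom ≫ f') (h₂ : g ≫ c.hom = b.hom ≫ g')
    (h₃ : δ ≫ a.hom⟦(1 : ℤ)⟧' = c.hom ≫ δ') : Triangle.mk f' g' δ' ∈ distTriang T :=
  isomorphic_distinguished _ h _ (Triangle.isoMk (Triangle.mk f g δ) (Triangle.mk f' g' δ')
    a b c h₁ h₂ h₃).symm

lemma mk_mem_distTriang_of_eq {X Y Z : T} {f f' : X ⟶ Y} {g g' : Y ⟶ Z} {δ δ' : Z ⟶ X⟦(1 : ℤ)⟧}
    (h : Triangle.mk f g δ ∈ distTriang T) (h₁ : f = f') (h₂ : g = g') (h₃ : δ = δ') :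
    Triangle.mk f' g' δ' ∈ distTriang T := by
  rwa [← h₁, ← h₂, ← h₃]

section

variable {X Y Z : T} {f : X ⟶ Y} {g : Y ⟶ Z} {δ : Z ⟶ X⟦(1 : ℤ)⟧}
  (h : Triangle.mk f g δ ∈ distTriang T)
include h

lemma comp_eq_zero₁₂ : f ≫ g = 0 := comp_distTriang_mor_zero₁₂ _ h

lemma comp_eq_zero₂₃ : g ≫ δ = 0 := comp_distTriang_mor_zero₂₃ _ h

lemma comp_eq_zero₃₁ : δ ≫ f⟦(1 : ℤ)⟧' = 0 := comp_distTriang_mor_zero₃₁ _ h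

lemma exists_lift₁ {W : T} (k : W ⟶ X⟦(1 : ℤ)⟧) (hk : k ≫ f⟦(1 : ℤ)⟧' = 0) :
    ∃ l : W ⟶ Z, k = l ≫ δ := Triangle.coyoneda_exact₁ _ h k hk

lemma exists_lift₂ {W : T} (k : W ⟶ Y) (hk : k ≫ g = 0) :
    ∃ l : W ⟶ X, k = l ≫ f := Triangle.coyoneda_exact₂ _ h k hk

lemma exists_lift₃ {W : T} (k : W ⟶ Z) (hk : k ≫ δ = 0) :
    ∃ l : W ⟶ Y, k = l ≫ g := Triangle.coyoneda_exact₃ _ h k hk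

lemma exists_desc₂ {W : T} (k : Y ⟶ W) (hk : f ≫ k = 0) :
    ∃ l : Z ⟶ W, k = g ≫ l := Triangle.yoneda_exact₂ _ h k hk

lemma exists_desc₃ {W : T} (k : Z ⟶ W) (hk : g ≫ k = 0) :
    ∃ l : X⟦(1 : ℤ)⟧ ⟶ W, k = δ ≫ l := Triangle.yoneda_exact₃ _ h k hk

lemma exists_completion₂ {X' Y' Z' : T} {f' : X' ⟶ Y'} {g' : Y' ⟶ Z'} {δ' : Z' ⟶ X'⟦(1 : ℤ)⟧}
    (h' : Triangle.mk f' g' δ' ∈ distTriang T) (a : X ⟶ X') (c : Z ⟶ Z')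
    (w : δ ≫ a⟦(1 : ℤ)⟧' = c ≫ δ') : ∃ b : Y ⟶ Y', f ≫ b = a ≫ f' ∧ g ≫ c = b ≫ g' :=
  complete_distinguished_triangle_morphism₂ _ _ h h' a c w

lemma exists_completion₃ {X' Y' Z' : T} {f' : X' ⟶ Y'} {g' : Y' ⟶ Z'} {δ' : Z' ⟶ X'⟦(1 : ℤ)⟧}
    (h' : Triangle.mk f' g' δ' ∈ distTriang T) (a : X ⟶ X') (b : Y ⟶ Y')
    (w : f ≫ b = a ≫ f') : ∃ c : Z ⟶ Z', g ≫ c = b ≫ g' ∧ δ ≫ a⟦(1 : ℤ)⟧' = c ≫ δ' :=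
  complete_distinguished_triangle_morphism _ _ h h' a b w

/-- Maps from the first term which vanish on the connecting map extend to the second term. -/
lemma exists_extension₁ {W : T} (k : X ⟶ W) (hk : δ ≫ k⟦(1 : ℤ)⟧' = 0) :
    ∃ l : Y ⟶ W, k = f ≫ l := by
  obtain ⟨b, hb, -⟩ := exists_completion₂ h (contractible_distinguished W) k (0 : Z ⟶ 0)
    (by rw [hk, zero_comp])
  exact ⟨b, by rw [hb, Category.comp_id]⟩

end

lemma IsTrianglePair.of_iso {X Y Z X' Y' Z' : T} {f : X ⟶ Y} {g : Y ⟶ Z} {f' : X' ⟶ Y'}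
    {g' : Y' ⟶ Z'} (a : X ≅ X') (b : Y ≅ Y') (c : Z ≅ Z')
    (h₁ : f ≫ b.hom = a.hom ≫ f') (h₂ : g ≫ c.hom = b.hom ≫ g')
    (h : IsTrianglePair f g) : IsTrianglePair f' g' := by
  obtain ⟨δ, hδ⟩ := h
  exact ⟨c.inv ≫ δ ≫ a.hom⟦(1 : ℤ)⟧', mk_mem_distTriang_of_iso hδ a b c h₁ h₂ (by simp)⟩

lemma isTrianglePair_zero_zero {X Y Z : T} (hX : IsZero X) (hY : IsZero Y) (hZ : IsZero Z)
    (f : X ⟶ Y) (g : Y ⟶ Z) : IsTrianglePair f g :=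
  IsTrianglePair.of_iso (f := 𝟙 (0 : T)) (g := (0 : (0 : T) ⟶ 0)) ((isZero_zero T).iso hX)
    ((isZero_zero T).iso hY) ((isZero_zero T).iso hZ)
    (hY.eq_of_tgt _ _) (hZ.eq_of_tgt _ _) ⟨0, contractible_distinguished _⟩

lemma isTrianglePair_id_zero (X : T) {Z : T} (hZ : IsZero Z) (g : X ⟶ Z) :
    IsTrianglePair (𝟙 X) g :=
  IsTrianglePair.of_iso (f := 𝟙 X) (g := (0 : X ⟶ 0)) (Iso.refl _) (Iso.refl _)
    ((isZero_zero T).iso hZ) (by simp) (hZ.eq_of_tgt _ _) ⟨0, contractible_distinguished _⟩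

/-- A triangle whose terms are shifts is the shift of a triangle, up to the signs of its maps. -/
lemma exists_isTrianglePair_of_shift {X Y Z : T} {f : X⟦(1 : ℤ)⟧ ⟶ Y⟦(1 : ℤ)⟧}
    {g : Y⟦(1 : ℤ)⟧ ⟶ Z⟦(1 : ℤ)⟧} (h : IsTrianglePair f g) :
    ∃ (f' : X ⟶ Y) (g' : Y ⟶ Z), IsTrianglePair f' g' := by
  obtain ⟨δ, hδ⟩ := h
  -- Three inverse rotations desuspend all terms. The signs they introduce are harmless, since only
  -- some pair of maps between the given objects is wanted.
  have h' := inv_rot_of_distTriang _ (inv_rot_of_distTriang _ (inv_rot_of_distTriang _ hδ))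
  let e (W : T) : (W⟦(1 : ℤ)⟧)⟦(-1 : ℤ)⟧ ≅ W := (shiftEquiv T (1 : ℤ)).unitIso.symm.app W
  exact ⟨_, _, IsTrianglePair.of_iso (e X) (e Y) (e Z)
    (f' := (e X).inv ≫ (Triangle.mk f g δ).invRotate.invRotate.invRotate.mor₁ ≫ (e Y).hom)
    (g' := (e Y).inv ≫ (Triangle.mk f g δ).invRotate.invRotate.invRotate.mor₂ ≫ (e Z).hom)
    (Iso.hom_inv_id_assoc _ _).symm (Iso.hom_inv_id_assoc _ _).symm ⟨_, h'⟩⟩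

end TrianglePairs

/-! ### Exact structures from embeddings without negative extensions. -/

section NonnegativeEmbeddings

variable {A : Type u} [Category.{v} A] [Preadditive A]
  {T : Type u'} [Category.{v'} T] [HasZeroObject T] [HasShift T ℤ]
  [Preadditive T] [∀ n : ℤ, (shiftFunctor T n).Additive]

/-- A fully faithful additive functor to a triangulated category without negative first extensions
between the objects of its image. -/
structure IsNonnegativeEmbedding (F : A ⥤ T) : Prop where
  full : F.Full
  faithful : F.Faithful
  additive : F.Additive
  neg : ∀ {X Y : A} (α : (F.obj X)⟦(1 : ℤ)⟧ ⟶ F.obj Y), α = 0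

namespace IsNonnegativeEmbedding

variable {F : A ⥤ T} (hF : IsNonnegativeEmbedding F)
include hF

/-- This lets the results on `F` be applied to the essential image itself, where the exact structure
of (II)(2) lives. -/
lemma ι_essImage : IsNonnegativeEmbedding F.essImage.ι where
  full := inferInstance
  faithful := inferInstance
  additive := inferInstance
  neg {X Y} α := by
    obtain ⟨X', ⟨eX⟩⟩ := X.property
    obtain ⟨Y', ⟨eY⟩⟩ := Y.property
    have : eX.hom⟦(1 : ℤ)⟧' ≫ α ≫ eY.inv = 0 := hF.neg _
    exact zero_of_comp_mono eY.inv (zero_of_epi_comp (eX.hom⟦(1 : ℤ)⟧') this)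

variable [Pretriangulated T]

lemma comp_eq_zero {X Y Z : A} {f : X ⟶ Y} {g : Y ⟶ Z}
    (h : IsTrianglePair (F.map f) (F.map g)) : f ≫ g = 0 := by
  obtain ⟨δ, hδ⟩ := h
  have := hF.faithful
  have := hF.additive
  exact F.map_injective (by rw [F.map_comp, F.map_zero, comp_eq_zero₁₂ hδ])

lemma exists_lift {X Y Z W : A} {f : X ⟶ Y} {g : Y ⟶ Z}
    (h : IsTrianglePair (F.map f) (F.map g)) (k : W ⟶ Y) (hk : k ≫ g = 0) :
    ∃ l : W ⟶ X, l ≫ f = k := by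
  obtain ⟨δ, hδ⟩ := h
  have := hF.full
  have := hF.faithful
  have := hF.additive
  obtain ⟨l, hl⟩ := exists_lift₂ hδ (F.map k)
    (by rw [← F.map_comp, hk, F.map_zero])
  obtain ⟨l, rfl⟩ := F.map_surjective l
  exact ⟨l, F.map_injective ((F.map_comp _ _).trans hl.symm)⟩

lemma exists_desc {X Y Z W : A} {f : X ⟶ Y} {g : Y ⟶ Z}
    (h : IsTrianglePair (F.map f) (F.map g)) (k : Y ⟶ W) (hk : f ≫ k = 0) :
    ∃ l : Z ⟶ W, g ≫ l = k := by
  obtain ⟨δ, hδ⟩ := h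
  have := hF.full
  have := hF.faithful
  have := hF.additive
  obtain ⟨l, hl⟩ := exists_desc₂ hδ (F.map k)
    (by rw [← F.map_comp, hk, F.map_zero])
  obtain ⟨l, rfl⟩ := F.map_surjective l
  exact ⟨l, F.map_injective ((F.map_comp _ _).trans hl.symm)⟩

/-- If `k ≫ f = 0`, the shift of `k` factors through the connecting map by a morphism from `Σ(F W)`
to `F Z`, which is zero by `neg`. The statement `epi` below uses `neg` in the same way. -/
lemma mono {X Y Z : A} {f : X ⟶ Y} {g : Y ⟶ Z}
    (h : IsTrianglePair (F.map f) (F.map g)) : Mono f := by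
  obtain ⟨δ, hδ⟩ := h
  have := hF.faithful
  have := hF.additive
  refine Preadditive.mono_of_cancel_zero _ fun {W} k hk => ?_
  obtain ⟨l, hl⟩ := exists_lift₁ hδ ((F.map k)⟦(1 : ℤ)⟧')
    (by rw [← Functor.map_comp, ← Functor.map_comp, hk, F.map_zero, Functor.map_zero])
  apply F.map_injective
  apply (shiftFunctor T (1 : ℤ)).map_injective
  rw [hl, hF.neg l, F.map_zero, Functor.map_zero, zero_comp]

lemma epi {X Y Z : A} {f : X ⟶ Y} {g : Y ⟶ Z}
    (h : IsTrianglePair (F.map f) (F.map g)) : Epi g := by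
  obtain ⟨δ, hδ⟩ := h
  have := hF.faithful
  have := hF.additive
  refine Preadditive.epi_of_cancel_zero _ fun {W} k hk => ?_
  obtain ⟨l, hl⟩ := exists_desc₃ hδ (F.map k)
    (by rw [← F.map_comp, hk, F.map_zero])
  apply F.map_injective
  rw [hl, hF.neg l, F.map_zero, comp_zero]

lemma nonempty_isLimit {X Y Z : A} {f : X ⟶ Y} {g : Y ⟶ Z}
    (h : IsTrianglePair (F.map f) (F.map g)) (w : f ≫ g = 0) :
    Nonempty (IsLimit (KernelFork.ofι f w)) := by
  have := hF.mono h
  exact ⟨KernelFork.IsLimit.ofι' _ _ fun k hk =>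
    Classical.indefiniteDescription _ (hF.exists_lift h k hk)⟩

lemma nonempty_isColimit {X Y Z : A} {f : X ⟶ Y} {g : Y ⟶ Z}
    (h : IsTrianglePair (F.map f) (F.map g)) (w : f ≫ g = 0) :
    Nonempty (IsColimit (CokernelCofork.ofπ g w)) := by
  have := hF.epi h
  exact ⟨CokernelCofork.IsColimit.ofπ' _ _ fun k hk =>
    Classical.indefiniteDescription _ (hF.exists_desc h k hk)⟩

/-- The conflations given by the triangles with terms in the image of the embedding. -/
def conflationStructure [HasZeroObject A] [HasBinaryBiproducts A] : ConflationStructure A where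
  IsConflation f g := IsTrianglePair (F.map f) (F.map g)
  zero h := hF.comp_eq_zero h
  isKernel h := hF.nonempty_isLimit h _
  isCokernel h := hF.nonempty_isColimit h _
  of_iso a b c h₁ h₂ h := h.of_iso (F.mapIso a) (F.mapIso b) (F.mapIso c)
    (by simp [← Functor.map_comp, h₁]) (by simp [← Functor.map_comp, h₂])

lemma exists_middle (hext : IsExtensionClosed F.essImage) {X Z : A}
    (δ : F.obj Z ⟶ (F.obj X)⟦(1 : ℤ)⟧) :
    ∃ (Y : A) (f : X ⟶ Y) (g : Y ⟶ Z), Triangle.mk (F.map f) (F.map g) δ ∈ distTriang T := by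
  have := hF.full
  obtain ⟨Y, f, g, h⟩ := distinguished_cocone_triangle₂ δ
  obtain ⟨Y', ⟨e⟩⟩ := hext f g ⟨_, h⟩ (F.obj_mem_essImage _) (F.obj_mem_essImage _)
  obtain ⟨f', hf'⟩ := F.map_surjective (f ≫ e.inv)
  obtain ⟨g', hg'⟩ := F.map_surjective (e.hom ≫ g)
  exact ⟨Y', f', g', mk_mem_distTriang_of_iso h (Iso.refl _) e.symm (Iso.refl _)
    (by simp [hf']) (by simp [hg']) (by simp)⟩

lemma exists_cone {X Y : A} (f : X ⟶ Y) {C : T} (g : F.obj Y ⟶ C)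
    (h : IsTrianglePair (F.map f) g) (hC : F.essImage C) :
    ∃ (Z : A) (g' : Y ⟶ Z), IsTrianglePair (F.map f) (F.map g') := by
  have := hF.full
  obtain ⟨Z, ⟨e⟩⟩ := hC
  obtain ⟨g', hg'⟩ := F.map_surjective (g ≫ e.inv)
  exact ⟨Z, g', h.of_iso (Iso.refl _) (Iso.refl _) e.symm (by simp) (by simp [hg'])⟩

lemma exists_fiber {Y Z : A} {K : T} (f : K ⟶ F.obj Y) (g : Y ⟶ Z)
    (h : IsTrianglePair f (F.map g)) (hK : F.essImage K) :
    ∃ (X : A) (f' : X ⟶ Y), IsTrianglePair (F.map f') (F.map g) := by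
  have := hF.full
  obtain ⟨X, ⟨e⟩⟩ := hK
  obtain ⟨f', hf'⟩ := F.map_surjective (e.hom ≫ f)
  exact ⟨X, f', h.of_iso e.symm (Iso.refl _) (Iso.refl _) (by simp [hf']) (by simp)⟩

/-- Pulling back the extension along `t` amounts to precomposing its class `δ` with `t`;
extension-closedness realises the new class. The square is cartesian, not merely weakly so, because
`f` is a monomorphism. -/
lemma exists_isPullback (hext : IsExtensionClosed F.essImage) {X Y Z V : A} {f : X ⟶ Y}
    {g : Y ⟶ Z} (h : IsTrianglePair (F.map f) (F.map g)) (t : V ⟶ Z) :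
    ∃ (U : A) (b : U ⟶ Y) (g' : U ⟶ V) (f' : X ⟶ U),
      IsPullback b g' g t ∧ IsTrianglePair (F.map f') (F.map g') := by
  have hmono := hF.mono h
  have h₀ := h
  obtain ⟨δ, hδ⟩ := h
  have := hF.full
  have := hF.faithful
  have := hF.additive
  obtain ⟨U, f', g', hU⟩ := hF.exists_middle hext (F.map t ≫ δ)
  have h₁ : IsTrianglePair (F.map f') (F.map g') := ⟨_, hU⟩
  obtain ⟨b, hb₁, hb₂⟩ := exists_completion₂ hU hδ (𝟙 _) (F.map t)
    (by simp)
  obtain ⟨b, rfl⟩ := F.map_surjective b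
  replace hb₁ : f' ≫ b = f := F.map_injective (by simpa using hb₁)
  replace hb₂ : g' ≫ t = b ≫ g := F.map_injective (by simpa using hb₂)
  refine ⟨U, b, g', f', isPullback_of_exists_lift hb₂.symm (fun {W} x y hxy => ?_)
    (fun l h₂ h₃ => ?_), h₁⟩
  -- First only `y` is lifted. The error in the other component is killed by `g`, hence comes from
  -- `X`, and is corrected through `f'`.
  · obtain ⟨l, hl⟩ : ∃ l : W ⟶ U, l ≫ g' = y := by
      obtain ⟨l, hl⟩ := exists_lift₃ hU (F.map y) (by
        rw [← F.map_comp_assoc, ← hxy, F.map_comp_assoc, comp_eq_zero₂₃ hδ, comp_zero])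
      obtain ⟨l, rfl⟩ := F.map_surjective l
      exact ⟨l, F.map_injective ((F.map_comp _ _).trans hl.symm)⟩
    obtain ⟨m, hm⟩ := hF.exists_lift h₀ (x - l ≫ b) (by
      rw [Preadditive.sub_comp, Category.assoc, ← hb₂, reassoc_of% hl, hxy, sub_self])
    exact ⟨l + m ≫ f', by simp [hb₁, hm], by simp [hl, hF.comp_eq_zero h₁]⟩
  · obtain ⟨r, rfl⟩ := hF.exists_lift h₁ l h₃
    rw [Category.assoc, hb₁] at h₂
    rw [zero_of_comp_mono f h₂, zero_comp]

lemma exists_isPushout (hext : IsExtensionClosed F.essImage) {X Y Z V : A} {f : X ⟶ Y}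
    {g : Y ⟶ Z} (h : IsTrianglePair (F.map f) (F.map g)) (t : X ⟶ V) :
    ∃ (W : A) (b : Y ⟶ W) (f' : V ⟶ W) (g' : W ⟶ Z),
      IsPushout f t b f' ∧ IsTrianglePair (F.map f') (F.map g') := by
  have hepi := hF.epi h
  have h₀ := h
  obtain ⟨δ, hδ⟩ := h
  have := hF.full
  have := hF.faithful
  have := hF.additive
  obtain ⟨W, f', g', hW⟩ := hF.exists_middle hext (δ ≫ (F.map t)⟦(1 : ℤ)⟧')
  have h₁ : IsTrianglePair (F.map f') (F.map g') := ⟨_, hW⟩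
  obtain ⟨b, hb₁, hb₂⟩ := exists_completion₂ hδ hW (F.map t) (𝟙 _)
    (by simp)
  obtain ⟨b, rfl⟩ := F.map_surjective b
  replace hb₁ : f ≫ b = t ≫ f' := F.map_injective (by simpa using hb₁)
  replace hb₂ : g = b ≫ g' := F.map_injective (by simpa using hb₂)
  refine ⟨W, b, f', g', isPushout_of_exists_desc hb₁ (fun {U} x y hxy => ?_)
    (fun l h₂ h₃ => ?_), h₁⟩
  · obtain ⟨l, hl⟩ : ∃ l : W ⟶ U, f' ≫ l = y := by
      obtain ⟨l, hl⟩ := exists_extension₁ hW (F.map y) (by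
        rw [Category.assoc, ← Functor.map_comp, ← F.map_comp, ← hxy, F.map_comp,
          Functor.map_comp, ← Category.assoc, comp_eq_zero₃₁ hδ, zero_comp])
      obtain ⟨l, rfl⟩ := F.map_surjective l
      exact ⟨l, F.map_injective ((F.map_comp _ _).trans hl.symm)⟩
    obtain ⟨m, hm⟩ := hF.exists_desc h₀ (x - b ≫ l) (by
      rw [Preadditive.comp_sub, reassoc_of% hb₁, hl, hxy, sub_self])
    exact ⟨l + g' ≫ m, by simp [← reassoc_of% hb₂, hm],
      by simp [hl, reassoc_of% (hF.comp_eq_zero h₁)]⟩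
  · obtain ⟨r, rfl⟩ := hF.exists_desc h₁ l h₃
    rw [← Category.assoc, ← hb₂] at h₂
    rw [zero_of_epi_comp g h₂, comp_zero]

/-- By the octahedral axiom, the cone of the composite is an extension of the two cones. -/
lemma exists_isTrianglePair_comp_inflation [IsTriangulated T]
    (hext : IsExtensionClosed F.essImage) {X Y Z C₁ C₂ : A} {f : X ⟶ Y} {g : Y ⟶ Z}
    {c₁ : Y ⟶ C₁} {c₂ : Z ⟶ C₂} (h₁ : IsTrianglePair (F.map f) (F.map c₁))
    (h₂ : IsTrianglePair (F.map g) (F.map c₂)) :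
    ∃ (C : A) (c : Z ⟶ C), IsTrianglePair (F.map (f ≫ g)) (F.map c) := by
  obtain ⟨δ₁, h₁⟩ := h₁
  obtain ⟨δ₂, h₂⟩ := h₂
  obtain ⟨C, c, δ, h⟩ := distinguished_cocone_triangle (F.map (f ≫ g))
  have o := Triangulated.someOctahedron (F.map_comp f g).symm h₁ h₂ h
  exact hF.exists_cone _ c ⟨_, h⟩ (hext _ _ ⟨_, o.mem⟩ (F.obj_mem_essImage _)
    (F.obj_mem_essImage _))

lemma exists_isTrianglePair_comp_deflation [IsTriangulated T]
    (hext : IsExtensionClosed F.essImage) {X Y Z K₁ K₂ : A} {f : X ⟶ Y} {g : Y ⟶ Z}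
    {k₁ : K₁ ⟶ X} {k₂ : K₂ ⟶ Y} (h₁ : IsTrianglePair (F.map k₁) (F.map f))
    (h₂ : IsTrianglePair (F.map k₂) (F.map g)) :
    ∃ (K : A) (k : K ⟶ X), IsTrianglePair (F.map k) (F.map (f ≫ g)) := by
  obtain ⟨δ₁, h₁⟩ := h₁
  obtain ⟨δ₂, h₂⟩ := h₂
  obtain ⟨K, k, δ, h⟩ := distinguished_cocone_triangle₁ (F.map (f ≫ g))
  -- On the rotated triangles the octahedron relates the suspended fibers `ΣK₁`, `ΣK`, `ΣK₂`;
  -- desuspending shows that `K` is an extension of `K₂` by `K₁`.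
  have o := Triangulated.someOctahedron (F.map_comp f g).symm (rot_of_distTriang _ h₁)
    (rot_of_distTriang _ h₂) (rot_of_distTriang _ h)
  obtain ⟨a, b, hab⟩ := exists_isTrianglePair_of_shift ⟨_, o.mem⟩
  exact hF.exists_fiber k _ ⟨_, h⟩ (hext _ _ hab (F.obj_mem_essImage _) (F.obj_mem_essImage _))

/-- If the image of the embedding is extension-closed, then the triangles with terms in it
form an exact structure. -/
lemma isExact [HasZeroObject A] [HasBinaryBiproducts A] [IsTriangulated T]
    (hext : IsExtensionClosed F.essImage) (S : ConflationStructure A)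
    (hS : ∀ (X Y Z : A) (f : X ⟶ Y) (g : Y ⟶ Z),
      S.IsConflation f g ↔ IsTrianglePair (F.map f) (F.map g)) : S.IsExact := by
  have := hF.additive
  have h₀ : S.IsConflation (𝟙 (0 : A)) (𝟙 (0 : A)) := by
    have hz : IsZero (F.obj (0 : A)) := F.map_isZero (isZero_zero A)
    rw [hS]
    exact isTrianglePair_zero_zero hz hz hz _ _
  refine ⟨⟨⟨_, _, h₀⟩, ?_, ?_⟩, ⟨⟨_, _, h₀⟩, ?_, ?_⟩⟩
  · rintro X Y Z f g ⟨K₁, k₁, h₁⟩ ⟨K₂, k₂, h₂⟩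
    rw [hS] at h₁ h₂
    obtain ⟨K, k, h⟩ := hF.exists_isTrianglePair_comp_deflation hext h₁ h₂
    exact ⟨K, k, (hS _ _ _ _ _).2 h⟩
  · rintro Y Z W g f ⟨K, k, h⟩
    obtain ⟨U, b, g', f', hp, h'⟩ := hF.exists_isPullback hext ((hS _ _ _ _ _).1 h) f
    exact ⟨U, b, g', hp, _, _, (hS _ _ _ _ _).2 h'⟩
  · rintro X Y Z f g ⟨C₁, c₁, h₁⟩ ⟨C₂, c₂, h₂⟩
    rw [hS] at h₁ h₂
    obtain ⟨K, k, h⟩ := hF.exists_isTrianglePair_comp_inflation hext h₁ h₂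
    exact ⟨K, k, (hS _ _ _ _ _).2 h⟩
  · rintro X Y Z f g ⟨K, k, h⟩
    obtain ⟨W, b, f', g', hp, h'⟩ := hF.exists_isPushout hext ((hS _ _ _ _ _).1 h) g
    exact ⟨W, b, f', hp, _, _, (hS _ _ _ _ _).2 h'⟩

end IsNonnegativeEmbedding

end NonnegativeEmbeddings

/-! ### Elementary consequences of the axioms R0* and R3. -/

namespace ConflationStructure

variable {E : Type u} [Category.{v} E] [Preadditive E] [HasZeroObject E] [HasBinaryBiproducts E]
  {S : ConflationStructure E}

lemma R0star.isConflation_of_isIso (hS : S.R0star) {X Y Z : E} (f : X ⟶ Y) [IsIso f]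
    (g : Y ⟶ Z) (hZ : IsZero Z) : S.IsConflation f g := by
  have h : S.Deflation g := by
    obtain ⟨K, k, hk⟩ := hS Y
    exact ⟨K, k, S.of_iso (Iso.refl _) (Iso.refl _) ((isZero_zero E).iso hZ)
      (by simp) (hZ.eq_of_tgt _ _) hk⟩
  exact h.isConflation (hZ.eq_of_tgt _ _) fun k _ => ⟨k ≫ inv f, by simp⟩

variable [S.IsRightExact]

lemma isConflation_of_isZero_of_isIso {X Y Z : E} (hX : IsZero X) (f : X ⟶ Y) (g : Y ⟶ Z)
    [IsIso g] : S.IsConflation f g := by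
  have h : S.Deflation g := Deflation.of_isPullback (g := 𝟙 (0 : E)) (f := (0 : Z ⟶ 0)) (f' := 0)
    (IsPullback.of_vert_isIso ⟨by simp⟩) IsRightExact.r0
  have : Mono f := ⟨fun _ _ _ => hX.eq_of_tgt _ _⟩
  exact h.isConflation (hX.eq_of_src _ _) fun k hk => ⟨0, by
    rw [zero_of_comp_mono g hk, zero_comp]⟩

/-- The composite `0 ⟶ A ⟶ 0` is the identity of `0`, a deflation by R0. -/
lemma R0star_of_R3 (h : S.R3) : S.R0star := fun A => by
  refine h (0 : (0 : E) ⟶ A) (0 : A ⟶ 0) inferInstance ?_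
  have : (0 : (0 : E) ⟶ A) ≫ (0 : A ⟶ 0) = 𝟙 0 := (isZero_zero E).eq_of_src _ _
  rw [this]
  exact IsRightExact.r0

/-- In a split sequence the projection is a deflation. -/
lemma R0star.deflation_of_split (hS : S.R0star) {K P A : E} (u : K ⟶ P) (g : P ⟶ A)
    (s : A ⟶ P) (r : P ⟶ K) (hs : s ≫ g = 𝟙 A) (hu : u ≫ g = 0) (hr : u ≫ r = 𝟙 K)
    (hsr : s ≫ r = 0) (h : g ≫ s + r ≫ u = 𝟙 P) : S.Deflation g := by
  -- The splitting makes `P` the product of `K` and `A`, so `g` is the pullback of `K ⟶ 0` along `A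
  -- ⟶ 0`.
  refine Deflation.of_isPullback (f' := r) (g := (0 : K ⟶ 0)) (f := (0 : A ⟶ 0))
    (isPullback_of_exists_lift (by simp) (fun x y _ => ⟨x ≫ u + y ≫ s, ?_, ?_⟩) fun l h₁ h₂ => ?_)
    (hS K)
  · simp [hr, hsr]
  · simp [hs, hu]
  · rw [← Category.comp_id l, ← h, Preadditive.comp_add, reassoc_of% h₁, reassoc_of% h₂]
    simp

end ConflationStructure

/-! ### Conflations and triangles for an effaceable nonnegative embedding. -/

section

variable {E : Type u} [Category.{v} E] [Preadditive E] [HasZeroObject E] [HasBinaryBiproducts E]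
  {S : ConflationStructure E}
  {T : Type u'} [Category.{v'} T] [HasZeroObject T] [HasShift T ℤ]
  [Preadditive T] [∀ n : ℤ, (shiftFunctor T n).Additive] [Pretriangulated T]
  {F : E ⥤ T} (hF : IsNonnegativeEmbedding F)

/-- Extensions between the objects of the image of `F` are killed by deflations. -/
def IsEffaceable (S : ConflationStructure E) (F : E ⥤ T) : Prop :=
  ∀ {X Z : E} (α : F.obj Z ⟶ (F.obj X)⟦(1 : ℤ)⟧), ∃ (W : E) (w : W ⟶ Z),
    S.Deflation w ∧ F.map w ≫ α = 0

/-- The triangle `A = A ⟶ 0` must come from a conflation. -/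
lemma R0star_of_isConflation_iff [F.Additive]
    (hS : ∀ (X Y Z : E) (f : X ⟶ Y) (g : Y ⟶ Z),
      S.IsConflation f g ↔ IsTrianglePair (F.map f) (F.map g)) : S.R0star :=
  fun A => ⟨A, 𝟙 A, (hS _ _ _ _ _).2 (by
    rw [F.map_id]
    exact isTrianglePair_id_zero _ (F.map_isZero (isZero_zero E)) _)⟩

namespace IsNonnegativeEmbedding

include hF

/-- Under axiom R3, the sequences that give triangles are conflations. -/
lemma isConflation_of_R3 (heff : IsEffaceable S F) (h : S.R3) {X Y Z : E} {f : X ⟶ Y} {g : Y ⟶ Z}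
    (hfg : IsTrianglePair (F.map f) (F.map g)) : S.IsConflation f g := by
  have w := hF.comp_eq_zero hfg
  have hker := (hF.nonempty_isLimit hfg w).some
  have := hF.mono hfg
  have hg : S.Deflation g := by
    obtain ⟨δ, hδ⟩ := hfg
    have := hF.full
    have := hF.faithful
    obtain ⟨W, w, hw, hwδ⟩ := heff δ
    obtain ⟨l, hl⟩ := exists_lift₃ hδ (F.map w) hwδ
    obtain ⟨l, rfl⟩ := F.map_surjective l
    -- The deflation `w` kills `δ`, so it factors through `g`; since `g` has the kernel `f`, axiom
    -- R3 applies.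
    obtain rfl : w = l ≫ g := F.map_injective (hl.trans (F.map_comp _ _).symm)
    exact h l g ⟨⟨_, hker⟩⟩ hw
  exact hg.isConflation w fun k hk => hF.exists_lift hfg k hk

/-- If `E` is exact, then its image is extension-closed. -/
lemma isExtensionClosed_of_isExact (heff : IsEffaceable S F)
    (hconf : ∀ {X Y Z : E} {f : X ⟶ Y} {g : Y ⟶ Z}, S.IsConflation f g →
      IsTrianglePair (F.map f) (F.map g)) (h : S.IsExact) : IsExtensionClosed F.essImage := by
  have := hF.full
  have := hF.faithful
  have := hF.additive
  have := h.2
  rintro X' Y' Z' f g ⟨δ, hδ⟩ ⟨X, ⟨eX⟩⟩ ⟨Z, ⟨eZ⟩⟩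
  have hα := mk_mem_distTriang_of_iso (f' := eX.hom ≫ f) (g' := g ≫ eZ.inv)
    (δ' := eZ.hom ≫ δ ≫ eX.inv⟦(1 : ℤ)⟧') hδ eX.symm (Iso.refl _) eZ.symm (by simp) (by simp)
    (by simp)
  generalize eZ.hom ≫ δ ≫ eX.inv⟦(1 : ℤ)⟧' = α at hα
  obtain ⟨W, w, ⟨K, k, hkw⟩, hw⟩ := heff α
  obtain ⟨ε, hε⟩ := hconf hkw
  -- As `w` kills `α`, the class `α` is the image of the class `ε` of `K ⟶ W ⟶ Z` under a map `t : K
  -- ⟶ X`. Pushing that conflation out along `t` should therefore realise `α`.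
  obtain ⟨β, hβ⟩ := exists_desc₃ hε α hw
  obtain ⟨β, rfl⟩ := (shiftFunctor T (1 : ℤ)).map_surjective β
  obtain ⟨t, rfl⟩ := F.map_surjective β
  obtain ⟨V, b, j, hV, ⟨C, c, hjc⟩⟩ := ConflationStructure.IsLeftExact.l2 (S := S) k t ⟨_, _, hkw⟩
  have := hkw.epi
  have := hjc.epi
  -- the cokernel of the pushout inflation is the cokernel of the original one
  let v : V ⟶ Z := hV.desc w 0 (by simp [S.zero hkw])
  have hbv : b ≫ v = w := hV.inl_desc _ _ _
  have hjv : j ≫ v = 0 := hV.inr_desc _ _ _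
  obtain ⟨y, hy⟩ := hjc.exists_desc v hjv
  obtain ⟨z, hz⟩ := hkw.exists_desc (b ≫ c) (by rw [reassoc_of% hV.w, S.zero hjc, comp_zero])
  have hvz : v ≫ z = c := by
    apply hV.hom_ext
    · rw [reassoc_of% hbv, hz]
    · rw [reassoc_of% hjv, zero_comp, S.zero hjc]
  have hjv' : S.IsConflation j v := S.of_iso (Iso.refl _) (Iso.refl _)
    ⟨y, z, by rw [← cancel_epi c, reassoc_of% hy, hvz, Category.comp_id],
      by rw [← cancel_epi w, ← hbv, Category.assoc, reassoc_of% hvz, hy, Category.comp_id]⟩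
    (by simp) (by simp [hy]) hjc
  obtain ⟨ζ, hζ⟩ := hconf hjv'
  obtain ⟨γ, hγ₁, hγ₂⟩ := exists_completion₃ hε hζ (F.map t) (F.map b)
    (by rw [← F.map_comp, ← F.map_comp, hV.w])
  obtain ⟨γ, rfl⟩ := F.map_surjective γ
  -- The completion is not unique, but its component on `Z` is forced because `w` is an epimorphism
  -- in `E`. Hence `ζ` is the class `α`, and `V` is the sought middle term.
  obtain rfl : γ = 𝟙 Z := by
    rw [← cancel_epi w, Category.comp_id]
    apply F.map_injective
    rw [F.map_comp, hγ₁, ← F.map_comp, hbv]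
  rw [F.map_id, Category.id_comp] at hγ₂
  rw [hβ, hγ₂] at hα
  exact ⟨V, ⟨Triangle.π₂.mapIso (isoTriangleOfIso₁₃ _ _ hζ hα (Iso.refl _) (Iso.refl _)
    (show ζ ≫ (𝟙 (F.obj X))⟦(1 : ℤ)⟧' = 𝟙 (F.obj Z) ≫ ζ by simp))⟩⟩

variable [S.IsRightExact]

/-- If the conflations are the sequences that give triangles, then axiom R3 holds. -/
lemma R3_of_isConflation_iff [IsTriangulated T]
    (hS : ∀ (X Y Z : E) (f : X ⟶ Y) (g : Y ⟶ Z),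
      S.IsConflation f g ↔ IsTrianglePair (F.map f) (F.map g)) : S.R3 := by
  have := hF.full
  have := hF.faithful
  have := hF.additive
  have h0 := R0star_of_isConflation_iff hS
  intro A B D i p hp hq
  obtain ⟨P, f', g', hP, hg'⟩ := ConflationStructure.IsRightExact.r2 (i ≫ p) p hq
  obtain ⟨L, l, hl⟩ := hg'
  -- A pullback preserves kernels: that of `g'` is carried by `f'` to that of `i ≫ p`.
  have hlq : S.IsConflation (l ≫ f') (i ≫ p) := by
    have := hl.mono
    have : Mono (l ≫ f') := Preadditive.mono_of_cancel_zero _ fun k hk => by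
      refine zero_of_comp_mono l (hP.hom_ext ?_ ?_)
      · simpa using hk
      · simp [S.zero hl]
    refine hq.isConflation (by rw [Category.assoc, hP.w, reassoc_of% (S.zero hl), zero_comp])
      fun k hk => ?_
    obtain ⟨m, hm⟩ := hl.exists_lift (hP.lift k 0 (by simpa using hk)) (by simp)
    exact ⟨m, by rw [reassoc_of% hm, hP.lift_fst]⟩
  -- Since `i ≫ p` factors through `p`, the projection `f'` has the section `(1, i)`, so `P` splits
  -- as `A` plus the kernel of `p`.
  let s : A ⟶ P := hP.lift (𝟙 A) i (by simp)
  let k := kernel.ι p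
  let u : kernel p ⟶ P := hP.lift 0 k (by simp [k])
  let r : P ⟶ kernel p := kernel.lift p (g' - f' ≫ i) (by simp [hP.w])
  have huf : u ≫ f' = 0 := hP.lift_fst _ _ _
  have hug : u ≫ g' = k := hP.lift_snd _ _ _
  have hrk : r ≫ k = g' - f' ≫ i := kernel.lift_ι _ _ _
  have hsf : s ≫ f' = 𝟙 A := hP.lift_fst _ _ _
  have hsg : s ≫ g' = i := hP.lift_snd _ _ _
  have hr : u ≫ r = 𝟙 _ := by
    rw [← cancel_mono k, Category.assoc, hrk, Preadditive.comp_sub, hug, reassoc_of% huf]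
    simp
  have hsr : s ≫ r = 0 := by
    rw [← cancel_mono k, Category.assoc, hrk, Preadditive.comp_sub, hsg, reassoc_of% hsf]
    simp
  have hid : f' ≫ s + r ≫ u = 𝟙 P := by
    apply hP.hom_ext
    · simp [hsf, huf]
    · simp [hsg, hug, hrk]
  have huf' : S.IsConflation u f' := by
    have : Mono u := ⟨fun a b hab => by simpa [hr] using hab =≫ r⟩
    refine (h0.deflation_of_split u f' s r hsf huf hr hsr hid).isConflation huf fun x hx =>
      ⟨x ≫ r, ?_⟩
    conv_rhs => rw [← Category.comp_id x, ← hid, Preadditive.comp_add, reassoc_of% hx]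
    simp
  have hepi := hl.epi
  obtain ⟨δ₁, h₁⟩ := (hS _ _ _ _ _).1 hl
  obtain ⟨δ₂, h₂⟩ := (hS _ _ _ _ _).1 hlq
  obtain ⟨δ₃, h₃⟩ := (hS _ _ _ _ _).1 huf'
  -- The cones of `l`, `f'` and `l ≫ f'` are `B`, `Σ(kernel p)` and `D`. The octahedral triangle is
  -- thus the rotation of the desired `kernel p ⟶ B ⟶ D`, once its first map is identified with `p`
  -- by cancelling the epimorphism `g'`.
  have o := Triangulated.someOctahedron (F.map_comp l f').symm h₁ (rot_of_distTriang _ h₃) h₂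
  obtain ⟨m, hm⟩ := F.map_surjective o.m₁
  obtain rfl : m = p := by
    rw [← cancel_epi g', ← hP.w]
    apply F.map_injective
    rw [F.map_comp, F.map_comp, hm]
    exact o.comm₁
  refine ⟨_, k, (hS _ _ _ _ _).2 ⟨o.m₃, ?_⟩⟩
  rw [rotate_distinguished_triangle]
  have e : (-(F.map u)⟦(1 : ℤ)⟧') ≫ (F.map g')⟦(1 : ℤ)⟧' = -(F.map k)⟦(1 : ℤ)⟧' := by
    rw [Preadditive.neg_comp, ← Functor.map_comp, ← F.map_comp, hug]
  exact mk_mem_distTriang_of_eq o.mem hm.symm rfl e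

end IsNonnegativeEmbedding

end

/-! ### Stalk complexes and acyclic complexes in the homotopy category. -/

section HomotopyCategoryLemmas

variable {E : Type u} [Category.{v} E] [Preadditive E] [HasZeroObject E]

/-- The stalk complex in degree `0`, as an object of the homotopy category. -/
noncomputable abbrev stalk : E ⥤ HomotopyCategory E (ComplexShape.up ℤ) :=
  HomologicalComplex.single E (ComplexShape.up ℤ) 0 ⋙ HomotopyCategory.quotient E _

/-- A morphism from a stalk complex which factors through a differential is null-homotopic. -/
lemma quotient_map_mkHomFromSingle_eq_zero {X : E} {N : CochainComplex E ℤ}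
    (a : X ⟶ N.X (-1)) (x : X ⟶ N.X 0) (hx : a ≫ N.d (-1) 0 = x)
    (hx' : ∀ k, (ComplexShape.up ℤ).Rel 0 k → x ≫ N.d 0 k = 0) :
    (HomotopyCategory.quotient E (ComplexShape.up ℤ)).map
      (HomologicalComplex.mkHomFromSingle x hx') = 0 := by
  -- The homotopy is `a` from degree `0` to degree `-1` and zero elsewhere.
  let h (i j : ℤ) (_ : (ComplexShape.up ℤ).Rel j i) :
      ((HomologicalComplex.single E (ComplexShape.up ℤ) 0).obj X).X i ⟶ N.X j :=
    if hij : i = 0 ∧ j = -1 then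
      (HomologicalComplex.XIsoOfEq _ hij.1).hom ≫
        (HomologicalComplex.singleObjXSelf (ComplexShape.up ℤ) 0 X).hom ≫ a ≫
        (N.XIsoOfEq hij.2.symm).hom
    else 0
  have e : HomologicalComplex.mkHomFromSingle x hx' = Homotopy.nullHomotopicMap' h := by
    apply HomologicalComplex.from_single_hom_ext
    rw [Homotopy.nullHomotopicMap'_f (k₂ := -1) (k₁ := 0) (k₀ := 1) (by simp) (by simp)]
    simp [h, HomologicalComplex.single_obj_d, hx]
  rw [e]
  exact (HomotopyCategory.eq_of_homotopy _ _ (Homotopy.nullHomotopy' h)).trans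
    (Functor.map_zero _ _ _)

lemma stalk_map_injective {X Y : E} {f g : X ⟶ Y} (h : stalk.map f = stalk.map g) : f = g := by
  have H := HomotopyCategory.homotopyOfEq _ _ h
  apply (HomologicalComplex.single E (ComplexShape.up ℤ) 0).map_injective
  apply HomologicalComplex.from_single_hom_ext
  rw [H.comm 0]
  simp [dNext, prevD, HomologicalComplex.single_obj_d]

lemma stalk_map_surjective {X Y : E} (φ : stalk.obj X ⟶ stalk.obj Y) :
    ∃ f : X ⟶ Y, stalk.map f = φ := by
  obtain ⟨φ, rfl⟩ := (HomotopyCategory.quotient E (ComplexShape.up ℤ)).map_surjective φ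
  obtain ⟨f, rfl⟩ := (HomologicalComplex.single E (ComplexShape.up ℤ) 0).map_surjective φ
  exact ⟨f, rfl⟩

lemma stalk_hom_shift_eq_zero {X Y : E} (φ : stalk.obj X ⟶ (stalk.obj Y)⟦(1 : ℤ)⟧) : φ = 0 := by
  let e := ((HomotopyCategory.quotient E (ComplexShape.up ℤ)).commShiftIso (1 : ℤ)).app
    ((HomologicalComplex.single E (ComplexShape.up ℤ) 0).obj Y)
  obtain ⟨ψ, hψ⟩ := (HomotopyCategory.quotient E (ComplexShape.up ℤ)).map_surjective (φ ≫ e.inv)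
  have : ψ = 0 := HomologicalComplex.from_single_hom_ext
    ((HomologicalComplex.isZero_single_obj_X (ComplexShape.up ℤ) 0 Y (0 + 1)
      (by decide)).eq_of_tgt _ _)
  rw [this, Functor.map_zero] at hψ
  exact zero_of_comp_mono e.inv hψ.symm

lemma shift_stalk_hom_eq_zero {X Y : E} (φ : (stalk.obj X)⟦(1 : ℤ)⟧ ⟶ stalk.obj Y) : φ = 0 := by
  let e := ((HomotopyCategory.quotient E (ComplexShape.up ℤ)).commShiftIso (1 : ℤ)).app
    ((HomologicalComplex.single E (ComplexShape.up ℤ) 0).obj X)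
  obtain ⟨ψ, hψ⟩ := (HomotopyCategory.quotient E (ComplexShape.up ℤ)).map_surjective (e.hom ≫ φ)
  have : ψ = 0 := HomologicalComplex.to_single_hom_ext
    ((HomologicalComplex.isZero_single_obj_X (ComplexShape.up ℤ) 0 X (0 + 1)
      (by decide)).eq_of_src _ _)
  rw [this, Functor.map_zero] at hψ
  exact zero_of_epi_comp e.hom hψ.symm

variable [HasBinaryBiproducts E] {S : ConflationStructure E}

/-- Morphisms from a stalk complex to an acyclic complex are killed by a deflation. -/
lemma exists_deflation_stalk_comp_eq_zero [S.IsRightExact] {X : E}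
    {N : HomotopyCategory E (ComplexShape.up ℤ)} (hN : acyclicComplexes S N)
    (f : stalk.obj X ⟶ N) :
    ∃ (W : E) (w : W ⟶ X), S.Deflation w ∧ stalk.map w ≫ f = 0 := by
  obtain ⟨N, rfl⟩ := HomotopyCategory.quotient_obj_surjective N
  obtain ⟨f, rfl⟩ := (HomotopyCategory.quotient E (ComplexShape.up ℤ)).map_surjective f
  obtain ⟨Z, ι, π, hc, hd⟩ := (isAcyclic_iff S N).1 hN
  let x : X ⟶ N.X 0 := (HomologicalComplex.singleObjXSelf (ComplexShape.up ℤ) 0 X).inv ≫ f.f 0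
  obtain ⟨x₀, hx₀⟩ := (hc 0 1 rfl).exists_lift x (by
    have := (hc 1 2 rfl).mono
    rw [← cancel_mono (ι 1), Category.assoc, hd]
    simp [x, HomologicalComplex.single_obj_d])
  -- The map amounts to a cycle `x₀` in degree `0`. Pulling back the deflation onto the cycles along
  -- `x₀` turns it into a boundary.
  obtain ⟨W, a, w, hW, hw⟩ := ConflationStructure.IsRightExact.r2 (S := S) (π (-1) 0 rfl) x₀
    ⟨_, _, hc _ _ _⟩
  refine ⟨W, w, hw, ?_⟩
  have hax : a ≫ N.d (-1) 0 = w ≫ x := by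
    rw [← hd (-1) 0 (by decide), ← hx₀, reassoc_of% hW.w]
  have e : (HomologicalComplex.single E (ComplexShape.up ℤ) 0).map w ≫ f =
      HomologicalComplex.mkHomFromSingle (w ≫ x) (fun k _ => by
        rw [← hax, Category.assoc, N.d_comp_d, comp_zero]) := by
    apply HomologicalComplex.from_single_hom_ext
    rw [HomologicalComplex.comp_f, HomologicalComplex.single_map_f_self]
    simp [x]
  rw [Functor.comp_map, ← Functor.map_comp, e]
  exact quotient_map_mkHomFromSingle_eq_zero a _ hax _

/-- A morphism from a stalk complex to an acyclic complex `M` factors through the truncation of `M`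
in nonpositive degrees, which is acyclic, and on which all morphisms from `M` to stalk complexes
vanish. -/
lemma exists_acyclic_factorization [S.IsRightExact] (hS : S.R0star) {X Y : E}
    {M : HomotopyCategory E (ComplexShape.up ℤ)} (hM : acyclicComplexes S M)
    (h : stalk.obj X ⟶ M) (m : M ⟶ stalk.obj Y) :
    ∃ (M' : HomotopyCategory E (ComplexShape.up ℤ)) (h' : stalk.obj X ⟶ M') (φ : M' ⟶ M),
      acyclicComplexes S M' ∧ h' ≫ φ = h ∧ φ ≫ m = 0 := by
  obtain ⟨M, rfl⟩ := HomotopyCategory.quotient_obj_surjective M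
  obtain ⟨h, rfl⟩ := (HomotopyCategory.quotient E (ComplexShape.up ℤ)).map_surjective h
  obtain ⟨m, rfl⟩ := (HomotopyCategory.quotient E (ComplexShape.up ℤ)).map_surjective m
  obtain ⟨Z, ι, π, hc, hd⟩ := (isAcyclic_iff S M).1 hM
  have hZ : ∀ n, ∃ (Z' : E) (z : Z' ⟶ Z n), (n ≤ 0 → IsIso z) ∧ (0 < n → IsZero Z') := fun n => by
    by_cases hn : n ≤ 0
    · exact ⟨Z n, 𝟙 _, fun _ => inferInstance, fun _ => by lia⟩
    · exact ⟨0, 0, fun _ => by lia, fun _ => isZero_zero E⟩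
  choose Z' z hz hz' using hZ
  -- The truncation keeps `M.X n` for `n < 0`, has the cycles `Z 0` in degree `0`, and is zero
  -- above. R0* provides the conflation ending it, from `Z 0` identically to itself and then to `0`.
  have hX : ∀ n, ∃ (X' : E) (φ : X' ⟶ M.X n) (i : Z' n ⟶ X') (p : X' ⟶ Z' (n + 1)),
      S.IsConflation i p ∧ i ≫ φ = z n ≫ ι n ∧ p ≫ z (n + 1) = φ ≫ π n (n + 1) rfl ∧
        (0 ≤ n → Epi i) := fun n => by
    by_cases hn : n < 0
    · have := hz n (by lia)
      have := hz (n + 1) (by lia)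
      exact ⟨M.X n, 𝟙 _, z n ≫ ι n, π n (n + 1) rfl ≫ inv (z (n + 1)),
        S.of_iso (asIso (z n)).symm (Iso.refl _) (asIso (z (n + 1))).symm (by simp) (by simp)
          (hc n (n + 1) rfl), by simp, by simp, fun _ => by lia⟩
    · exact ⟨Z' n, z n ≫ ι n, 𝟙 _, 0, hS.isConflation_of_isIso _ _ (hz' _ (by lia)), by simp,
        by simp [S.zero (hc n (n + 1) rfl)], fun _ => inferInstance⟩
  choose X' φ i p hip hiφ hpz hi using hX
  let M' : CochainComplex E ℤ := CochainComplex.of X' (fun n => p n ≫ i (n + 1)) fun n => by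
    rw [Category.assoc, reassoc_of% (S.zero (hip (n + 1))), zero_comp, comp_zero]
  have hd' (n : ℤ) : M'.d n (n + 1) = p n ≫ i (n + 1) :=
    CochainComplex.of_d X' (fun n => p n ≫ i (n + 1)) n
  have hM' : IsAcyclic S M' := by
    have hπ : ∀ j n, j + 1 = n → ∃ π' : X' j ⟶ Z' n, S.IsConflation (i j) π' ∧
        π' ≫ i n = M'.d j n := by
      rintro j _ rfl
      exact ⟨p j, hip j, (hd' j).symm⟩
    choose π' hπ₁ hπ₂ using hπ
    exact (isAcyclic_iff S M').2 ⟨Z', i, π', hπ₁, hπ₂⟩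
  let Φ : M' ⟶ M :=
    { f := φ
      comm' := by
        rintro j _ rfl
        rw [hd', Category.assoc, hiφ, reassoc_of% (hpz j), hd] }
  let x : X ⟶ M.X 0 := (HomologicalComplex.singleObjXSelf (ComplexShape.up ℤ) 0 X).inv ≫ h.f 0
  obtain ⟨x₀, hx₀⟩ := (hc 0 1 rfl).exists_lift x (by
    have := (hc 1 2 rfl).mono
    rw [← cancel_mono (ι 1), Category.assoc, hd]
    simp [x, HomologicalComplex.single_obj_d])
  have := hz 0 le_rfl
  let h' : (HomologicalComplex.single E (ComplexShape.up ℤ) 0).obj X ⟶ M' :=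
    HomologicalComplex.mkHomFromSingle (x₀ ≫ inv (z 0) ≫ i 0) (by
      rintro _ rfl
      rw [hd', Category.assoc, Category.assoc, reassoc_of% (S.zero (hip 0)), zero_comp, comp_zero,
        comp_zero])
  refine ⟨(HomotopyCategory.quotient E (ComplexShape.up ℤ)).obj M',
    (HomotopyCategory.quotient E (ComplexShape.up ℤ)).map h',
    (HomotopyCategory.quotient E (ComplexShape.up ℤ)).map Φ, hM', ?_, ?_⟩
  · rw [← Functor.map_comp]
    congr 1
    apply HomologicalComplex.from_single_hom_ext
    rw [HomologicalComplex.comp_f, HomologicalComplex.mkHomFromSingle_f, Category.assoc,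
      Category.assoc, Category.assoc]
    change _ ≫ x₀ ≫ inv (z 0) ≫ i 0 ≫ φ 0 = _
    rw [hiφ, IsIso.inv_hom_id_assoc, hx₀, Iso.hom_inv_id_assoc]
  · rw [← Functor.map_comp]
    have : Φ ≫ m = 0 := by
      -- Only degree `0` matters. There `m` kills the cycles, because the deflation `π (-1) 0` onto
      -- them composes to a differential and the stalk has zero differential.
      apply HomologicalComplex.to_single_hom_ext
      have := hi 0 le_rfl
      have := (hc (-1) 0 (by decide)).epi
      refine zero_of_epi_comp (i 0) ?_
      change i 0 ≫ φ 0 ≫ m.f 0 = 0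
      have hm : ι 0 ≫ m.f 0 = 0 := zero_of_epi_comp (π (-1) 0 (neg_add_cancel 1)) (by
        rw [← Category.assoc, hd, ← m.comm, HomologicalComplex.single_obj_d, comp_zero])
      rw [← Category.assoc, hiφ, Category.assoc, hm, comp_zero]
    rw [this, Functor.map_zero]

end HomotopyCategoryLemmas

/-! ### Morphisms between stalks in the derived category. -/

section DerivedCategoryLemmas

variable {E : Type u} [Category.{v} E] [Preadditive E] [HasZeroObject E] [HasBinaryBiproducts E]
  {S : ConflationStructure E} [S.IsRightExact]

lemma isZero_Q_obj {N : HomotopyCategory E (ComplexShape.up ℤ)} (hN : acyclicComplexes S N) :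
    IsZero ((acyclicComplexes S).trW.Q.obj N) := by
  have := Localization.inverts (acyclicComplexes S).trW.Q (acyclicComplexes S).trW _
    (ObjectProperty.trW.mk _ (contractible_distinguished₁ N) hN)
  exact IsZero.of_iso (Functor.map_isZero _ (isZero_zero _))
    (asIso ((acyclicComplexes S).trW.Q.map (Triangle.mk (0 : 0 ⟶ N) (𝟙 N) 0).mor₁)).symm

/-- The obstruction to lifting through `s` lies in its acyclic cone, where a deflation kills it. -/
lemma exists_stalk_lift {X : E} {C : HomotopyCategory E (ComplexShape.up ℤ)}
    (s : C ⟶ stalk.obj X) (hs : (acyclicComplexes S).trW s) :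
    ∃ (W : E) (w : W ⟶ X) (t : stalk.obj W ⟶ C), S.Deflation w ∧ t ≫ s = stalk.map w := by
  obtain ⟨N, g, δ, hT, hN⟩ := ((acyclicComplexes S).trW_iff s).1 hs
  obtain ⟨W, w, hw, hwg⟩ := exists_deflation_stalk_comp_eq_zero hN g
  obtain ⟨t, ht⟩ := exists_lift₂ hT _ hwg
  exact ⟨W, w, t, hw, ht.symm⟩

/-- Up to a deflation, a morphism in the derived category from a stalk complex comes from
the homotopy category. -/
lemma exists_deflation_Q_map {X : E} {L : HomotopyCategory E (ComplexShape.up ℤ)}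
    (α : (acyclicComplexes S).trW.Q.obj (stalk.obj X) ⟶ (acyclicComplexes S).trW.Q.obj L) :
    ∃ (W : E) (w : W ⟶ X) (β : stalk.obj W ⟶ L), S.Deflation w ∧
      (acyclicComplexes S).trW.Q.map (stalk.map w) ≫ α = (acyclicComplexes S).trW.Q.map β := by
  obtain ⟨φ, rfl⟩ := Localization.exists_rightFraction (acyclicComplexes S).trW.Q
    (acyclicComplexes S).trW α
  obtain ⟨W, w, t, hw, ht⟩ := exists_stalk_lift φ.s φ.hs
  refine ⟨W, w, t ≫ φ.f, hw, ?_⟩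
  rw [← ht, Functor.map_comp, Functor.map_comp, Category.assoc,
    MorphismProperty.RightFraction.map_s_comp_map]

lemma eq_zero_of_Q_map_stalk_map_eq_zero {X Y : E} (f : X ⟶ Y)
    (hf : (acyclicComplexes S).trW.Q.map (stalk.map f) = 0) : f = 0 := by
  have hf' : (acyclicComplexes S).trW.Q.map (stalk.map f) =
      (acyclicComplexes S).trW.Q.map 0 := by rw [hf, Functor.map_zero]
  rw [MorphismProperty.map_eq_iff_precomp _ (acyclicComplexes S).trW] at hf'
  obtain ⟨C, s, hs, h⟩ := hf'
  obtain ⟨W, w, t, ⟨_, _, hw⟩, ht⟩ := exists_stalk_lift s hs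
  have := hw.epi
  refine zero_of_epi_comp w (stalk_map_injective ?_)
  rw [Functor.map_comp, ← ht, Category.assoc, h, comp_zero, comp_zero, Functor.map_zero]

/-- The numerator of a left fraction representing `α` is shown to factor through an acyclic complex
in the homotopy category: the truncated fiber of the denominator, shifted by one. -/
lemma shift_stalk_Q_hom_eq_zero (hS : S.R0star) {X Y : E}
    (α : (acyclicComplexes S).trW.Q.obj ((stalk.obj X)⟦(1 : ℤ)⟧) ⟶
      (acyclicComplexes S).trW.Q.obj (stalk.obj Y)) : α = 0 := by
  obtain ⟨φ, rfl⟩ := Localization.exists_leftFraction (acyclicComplexes S).trW.Q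
    (acyclicComplexes S).trW α
  obtain ⟨M, m, ε, hT, hM⟩ := ((acyclicComplexes S).trW_iff' φ.s).1 φ.hs
  obtain ⟨h, hh⟩ := (shiftFunctor _ (1 : ℤ)).map_surjective (φ.f ≫ ε)
  obtain ⟨M', h', ψ, hM', hψ, hm⟩ := exists_acyclic_factorization hS hM h m
  obtain ⟨χ, hχ⟩ := exists_lift₁ hT (ψ⟦(1 : ℤ)⟧') (by
    rw [← Functor.map_comp, hm, Functor.map_zero])
  -- After subtracting the part through `M'`, the rest comes from a map `ΣX ⟶ Y` in the homotopy
  -- category, which is zero for degree reasons.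
  obtain ⟨r, hr⟩ := exists_lift₃ hT (φ.f - h'⟦(1 : ℤ)⟧' ≫ χ) (by
    rw [Preadditive.sub_comp, Category.assoc, ← hχ, ← Functor.map_comp, hψ, hh, sub_self])
  rw [shift_stalk_hom_eq_zero r, zero_comp, sub_eq_zero] at hr
  have hf : (acyclicComplexes S).trW.Q.map φ.f = 0 := by
    rw [hr, Functor.map_comp]
    have : IsZero ((acyclicComplexes S).trW.Q.obj (M'⟦(1 : ℤ)⟧)) :=
      isZero_Q_obj ((acyclicComplexes S).le_shift 1 _ hM')
    rw [this.eq_of_tgt ((acyclicComplexes S).trW.Q.map (h'⟦(1 : ℤ)⟧')) 0, zero_comp]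
  rw [MorphismProperty.LeftFraction.map, hf, zero_comp]

end DerivedCategoryLemmas

/-! ### The acyclic complex of a conflation and its iterated mapping cone. -/

section ConflationComplexes

variable {E : Type u} [Category.{v} E] [Preadditive E] [HasZeroObject E] [HasBinaryBiproducts E]
  {S : ConflationStructure E}

/-- Free indices replace `n - 2`, `n - 1` and `n + 1`, so that numerals can be used without
transport. -/
lemma isAcyclicInDegree_of_factorization {K : CochainComplex E ℤ} (l j n m : ℤ) (hl : l + 1 = j)
    (hj : j + 1 = n) (hn : n + 1 = m) {Z : E} (p : K.X j ⟶ Z) (i : Z ⟶ K.X n)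
    (hpi : p ≫ i = K.d j n) (hp : S.Deflation p) (hi : S.Inflation i)
    (hdesc : ∀ {W : E} (k : K.X j ⟶ W), K.d l j ≫ k = 0 → ∃ k' : Z ⟶ W, p ≫ k' = k)
    (hlift : ∀ {W : E} (k : W ⟶ K.X n), k ≫ K.d n m = 0 → ∃ k' : W ⟶ Z, k' ≫ i = k) :
    IsAcyclicInDegree S K n := by
  obtain rfl : j = n - 1 := by lia
  obtain rfl : l = n - 2 := by lia
  subst hn
  obtain ⟨_, _, hp'⟩ := id hp
  obtain ⟨_, _, hi'⟩ := id hi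
  have := hp'.epi
  have := hi'.mono
  exact ⟨Z, p, i, hpi, hp, hi,
    ⟨zero_of_comp_mono i (by rw [Category.assoc, hpi, K.d_comp_d]),
      ⟨CokernelCofork.IsColimit.ofπ' _ _ fun k hk =>
        Classical.indefiniteDescription _ (hdesc k hk)⟩⟩,
    ⟨zero_of_epi_comp p (by rw [← Category.assoc, hpi, K.d_comp_d]),
      ⟨KernelFork.IsLimit.ofι' _ _ fun k hk =>
        Classical.indefiniteDescription _ (hlift k hk)⟩⟩⟩

variable [S.IsRightExact]

/-- A conflation, considered as a complex, is acyclic. -/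
lemma isAcyclic_of_isConflation (hS : S.R0star) {K : CochainComplex E ℤ}
    (hK : ∀ n, n ≠ -2 → n ≠ -1 → n ≠ 0 → IsZero (K.X n))
    (h : S.IsConflation (K.d (-2) (-1)) (K.d (-1) 0)) : IsAcyclic S K := by
  have := h.mono
  have := h.epi
  have hid (A : E) : S.IsConflation (𝟙 A) (0 : A ⟶ 0) :=
    hS.isConflation_of_isIso _ _ (isZero_zero E)
  have hid' (A : E) : S.IsConflation (0 : 0 ⟶ A) (𝟙 A) :=
    ConflationStructure.isConflation_of_isZero_of_isIso (isZero_zero E) _ _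
  intro n
  by_cases h₁ : n = -1
  · subst h₁
    exact isAcyclicInDegree_of_factorization (-3) (-2) (-1) 0 rfl rfl rfl (𝟙 _) (K.d (-2) (-1))
      (Category.id_comp _) ⟨_, _, hid' _⟩ ⟨_, _, h⟩ (fun k _ => ⟨k, Category.id_comp _⟩)
      fun k hk => h.exists_lift k hk
  by_cases h₂ : n = 0
  · subst h₂
    exact isAcyclicInDegree_of_factorization (-2) (-1) 0 1 rfl rfl rfl (K.d (-1) 0) (𝟙 _)
      (Category.comp_id _) ⟨_, _, h⟩ ⟨_, _, hid _⟩ (fun k hk => h.exists_desc k hk)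
      fun k _ => ⟨k, Category.comp_id _⟩
  -- In all other degrees the differential factors through `0`. The boundary cases are `n = -2`,
  -- where the inflation is monic, and `n = 1`, where the deflation is epic.
  · refine isAcyclicInDegree_of_factorization (n - 1 - 1) (n - 1) n (n + 1) (by lia) (by lia) rfl
      (0 : K.X (n - 1) ⟶ 0) (0 : 0 ⟶ K.X n) ?_ ⟨_, _, hid _⟩ ⟨_, _, hid' _⟩ ?_ ?_
    · rw [comp_zero]
      by_cases h₃ : n = -2
      · exact (hK _ (by lia) (by lia) (by lia)).eq_of_src _ _
      · exact (hK _ h₃ h₁ h₂).eq_of_tgt _ _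
    · intro W k hk
      refine ⟨0, ?_⟩
      rw [comp_zero]
      by_cases h₃ : n = 1
      · subst h₃
        exact (zero_of_epi_comp (K.d (-1) 0) hk).symm
      · exact (hK _ (by lia) (by lia) (by lia)).eq_of_src _ _
    · intro W k hk
      refine ⟨0, ?_⟩
      rw [comp_zero]
      by_cases h₃ : n = -2
      · subst h₃
        exact (zero_of_comp_mono (K.d (-2) (-1)) hk).symm
      · exact (hK _ h₃ h₁ h₂).eq_of_tgt _ _

open CochainComplex CochainComplex.HomComplex

/-- The morphism from the mapping cone of the inflation of a conflation to the third term. -/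
noncomputable def coneToStalk {X Y Z : E} (f : X ⟶ Y) (g : Y ⟶ Z) (w : f ≫ g = 0) :
    mappingCone ((HomologicalComplex.single E (ComplexShape.up ℤ) 0).map f) ⟶
      (HomologicalComplex.single E (ComplexShape.up ℤ) 0).obj Z :=
  mappingCone.desc _ 0 ((HomologicalComplex.single E (ComplexShape.up ℤ) 0).map g)
    (by rw [← Functor.map_comp, w, Functor.map_zero]; simp)

/-- The iterated cone is the complex `X ⟶ Y ⟶ Z` in degrees `-2`, `-1`, `0`. -/
lemma isAcyclic_mappingCone_coneToStalk (hS : S.R0star) {X Y Z : E} {f : X ⟶ Y} {g : Y ⟶ Z}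
    (h : S.IsConflation f g) : IsAcyclic S (mappingCone (coneToStalk f g (S.zero h))) := by
  let s := HomologicalComplex.single E (ComplexShape.up ℤ) 0
  let σ (A : E) : (s.obj A).X 0 ≅ A := HomologicalComplex.singleObjXSelf (ComplexShape.up ℤ) 0 A
  have hs (A : E) (n : ℤ) (hn : n ≠ 0) : IsZero ((s.obj A).X n) :=
    HomologicalComplex.isZero_single_obj_X _ _ _ _ hn
  let φ := s.map f
  have hφ : φ.f 0 = (σ X).hom ≫ f ≫ (σ Y).inv := HomologicalComplex.single_map_f_self _ _ _
  have hγ : (s.map g).f 0 = (σ Y).hom ≫ g ≫ (σ Z).inv :=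
    HomologicalComplex.single_map_f_self _ _ _
  let θ : mappingCone φ ⟶ s.obj Z := coneToStalk f g (S.zero h)
  have hθ : (mappingCone.inr φ).f 0 ≫ θ.f 0 = (s.map g).f 0 := by
    simp [θ, coneToStalk, φ, s]
  refine isAcyclic_of_isConflation hS (fun n h₁ h₂ h₃ => ?_) ?_
  · rw [mappingCone.isZero_X_iff, mappingCone.isZero_X_iff]
    exact ⟨⟨hs _ _ (by lia), hs _ _ (by lia)⟩, hs _ _ (by lia)⟩
  change S.IsConflation ((mappingCone θ).d (-2) (-1)) ((mappingCone θ).d (-1) 0)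
  -- The sign cancels the one with which the differential of the inner cone enters the outer cone.
  let a : X ≅ (mappingCone θ).X (-2) :=
    { hom := -((σ X).inv ≫ (mappingCone.inl φ).v 0 (-1) rfl ≫ (mappingCone.inl θ).v (-1) (-2) rfl)
      inv := -((mappingCone.fst θ).1.v (-2) (-1) rfl ≫ (mappingCone.fst φ).1.v (-1) 0 rfl ≫
        (σ X).hom)
      hom_inv_id := by simp
      inv_hom_id := by
        apply mappingCone.ext_to θ (-2) (-1) rfl
        · apply mappingCone.ext_to φ (-1) 0 rfl
          · simp
          · exact (hs _ _ (by decide)).eq_of_tgt _ _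
        · exact (hs _ _ (by decide)).eq_of_tgt _ _ }
  let b : Y ≅ (mappingCone θ).X (-1) :=
    { hom := (σ Y).inv ≫ (mappingCone.inr φ).f 0 ≫ (mappingCone.inl θ).v 0 (-1) rfl
      inv := (mappingCone.fst θ).1.v (-1) 0 rfl ≫ (mappingCone.snd φ).v 0 0 rfl ≫ (σ Y).hom
      hom_inv_id := by simp
      inv_hom_id := by
        apply mappingCone.ext_to θ (-1) 0 rfl
        · apply mappingCone.ext_to φ 0 1 rfl
          · exact (hs _ _ (by decide)).eq_of_tgt _ _
          · simp
        · exact (hs _ _ (by decide)).eq_of_tgt _ _ }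
  let c : Z ≅ (mappingCone θ).X 0 :=
    { hom := (σ Z).inv ≫ (mappingCone.inr θ).f 0
      inv := (mappingCone.snd θ).v 0 0 rfl ≫ (σ Z).hom
      hom_inv_id := by simp
      inv_hom_id := by
        apply mappingCone.ext_to θ 0 1 rfl
        · exact ((mappingCone.isZero_X_iff φ 1).2
            ⟨hs _ _ (by decide), hs _ _ (by decide)⟩).eq_of_tgt _ _
        · simp }
  refine S.of_iso a b c ?_ ?_ h
  · have h₁ : θ.f (-1) = 0 := (hs _ _ (by decide)).eq_of_tgt _ _
    simp only [a, b, Preadditive.neg_comp, Category.assoc]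
    rw [mappingCone.inl_v_d θ (-1) (-2) 0 rfl rfl, h₁, zero_comp, zero_sub, Preadditive.comp_neg,
      reassoc_of% (mappingCone.inl_v_d φ 0 (-1) 1 rfl rfl)]
    simp [hφ, HomologicalComplex.single_obj_d, s]
  · simp only [b, c, Category.assoc]
    rw [mappingCone.inl_v_d θ 0 (-1) 1 rfl rfl, Preadditive.comp_sub, reassoc_of% hθ]
    simp [hγ, HomologicalComplex.single_obj_d, s]

end ConflationComplexes

/-! ### The embedding of `E` is nonnegative and effaceable. -/

section Embedding

variable {E : Type u} [Category.{v} E] [Preadditive E] [HasZeroObject E] [HasBinaryBiproducts E]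
  {S : ConflationStructure E} [S.IsRightExact]

/-- The comparison from the cone of `f` to `Z` has acyclic cone, so `Z` replaces the cone in the
standard triangle. -/
lemma isTrianglePair_Q_of_isConflation (hS : S.R0star) {X Y Z : E} {f : X ⟶ Y} {g : Y ⟶ Z}
    (h : S.IsConflation f g) :
    IsTrianglePair ((acyclicComplexes S).trW.Q.map (stalk.map f))
      ((acyclicComplexes S).trW.Q.map (stalk.map g)) := by
  let q := HomotopyCategory.quotient E (ComplexShape.up ℤ)
  let θ := coneToStalk f g (S.zero h)
  have := Localization.inverts (acyclicComplexes S).trW.Q (acyclicComplexes S).trW (q.map θ)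
    (ObjectProperty.trW.mk _ (HomotopyCategory.mappingCone_triangleh_distinguished θ)
      (isAcyclic_mappingCone_coneToStalk hS h))
  have hT := (acyclicComplexes S).trW.Q.map_distinguished _
    (HomotopyCategory.mappingCone_triangleh_distinguished
      ((HomologicalComplex.single E (ComplexShape.up ℤ) 0).map f))
  refine IsTrianglePair.of_iso (Iso.refl _) (Iso.refl _)
    (asIso ((acyclicComplexes S).trW.Q.map (q.map θ))) ?_ ?_ ⟨_, hT⟩
  · exact (Category.comp_id _).trans (Category.id_comp _).symm
  · refine Eq.trans ?_ (Category.id_comp _).symm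
    change (acyclicComplexes S).trW.Q.map (q.map (CochainComplex.mappingCone.inr _)) ≫
      (acyclicComplexes S).trW.Q.map (q.map θ) = (acyclicComplexes S).trW.Q.map (q.map _)
    rw [← Functor.map_comp, ← Functor.map_comp]
    simp only [θ, coneToStalk, CochainComplex.mappingCone.inr_desc]

lemma isTrianglePair_of_ι {T : Type u'} [Category.{v'} T] [HasZeroObject T] [HasShift T ℤ]
    [Preadditive T] [∀ n : ℤ, (shiftFunctor T n).Additive] [Pretriangulated T]
    (P : ObjectProperty T) [P.IsTriangulated] {X Y Z : P.FullSubcategory} {f : X ⟶ Y} {g : Y ⟶ Z}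
    (h : IsTrianglePair f.hom g.hom) : IsTrianglePair f g := by
  obtain ⟨δ, hδ⟩ := h
  refine ⟨P.fullyFaithfulι.preimage (δ ≫ (P.ι.commShiftIso (1 : ℤ)).inv.app X), ?_⟩
  have h : Triangle.mk f.hom g.hom (P.ι.map (P.fullyFaithfulι.preimage
      (δ ≫ (P.ι.commShiftIso (1 : ℤ)).inv.app X)) ≫ (P.ι.commShiftIso (1 : ℤ)).hom.app X) ∈
        distTriang T :=
    mk_mem_distTriang_of_eq hδ rfl rfl (by
      rw [P.fullyFaithfulι.map_preimage]
      simp)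
  exact h

lemma isTrianglePair_embedding (hS : S.R0star) {X Y Z : E} {f : X ⟶ Y} {g : Y ⟶ Z}
    (h : S.IsConflation f g) :
    IsTrianglePair ((embedding S).map f) ((embedding S).map g) :=
  isTrianglePair_of_ι _ (isTrianglePair_Q_of_isConflation hS h)

lemma isEffaceable_embedding : IsEffaceable S (embedding S) := fun {X Z} α => by
  let L := (acyclicComplexes S).trW.Q
  let e : (boundedObjects S).ι.obj (((embedding S).obj X)⟦(1 : ℤ)⟧) ≅
      L.obj ((stalk.obj X)⟦(1 : ℤ)⟧) :=
    ((boundedObjects S).ι.commShiftIso (1 : ℤ)).app ((embedding S).obj X) ≪≫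
      ((L.commShiftIso (1 : ℤ)).app (stalk.obj X)).symm
  obtain ⟨W, w, β, hw, h⟩ := exists_deflation_Q_map
    (show L.obj (stalk.obj Z) ⟶ L.obj ((stalk.obj X)⟦(1 : ℤ)⟧) from α.hom ≫ e.hom)
  rw [stalk_hom_shift_eq_zero β, Functor.map_zero] at h
  refine ⟨W, w, hw, ?_⟩
  ext
  refine zero_of_comp_mono e.hom ?_
  exact (Category.assoc _ _ _).trans h

lemma eq_zero_of_embedding_map_eq_zero {X Y : E} (f : X ⟶ Y) (h : (embedding S).map f = 0) :
    f = 0 :=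
  eq_zero_of_Q_map_stalk_map_eq_zero (S := S) f (congrArg (fun k => k.hom) h)

lemma shift_embedding_hom_eq_zero (hS : S.R0star) {X Y : E}
    (α : ((embedding S).obj X)⟦(1 : ℤ)⟧ ⟶ (embedding S).obj Y) : α = 0 := by
  let L := (acyclicComplexes S).trW.Q
  let e : (boundedObjects S).ι.obj (((embedding S).obj X)⟦(1 : ℤ)⟧) ≅
      L.obj ((stalk.obj X)⟦(1 : ℤ)⟧) :=
    ((boundedObjects S).ι.commShiftIso (1 : ℤ)).app ((embedding S).obj X) ≪≫
      ((L.commShiftIso (1 : ℤ)).app (stalk.obj X)).symm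
  ext
  refine zero_of_epi_comp e.inv ?_
  exact shift_stalk_Q_hom_eq_zero (S := S) (X := X) (Y := Y) hS _

/-- Up to a deflation `w`, the map `α` comes from `E`; it descends along `w` to some `f`, as `w` is
a cokernel. The difference of `α` and the image of `f` vanishes on `w`, hence factors through a map
`ΣK ⟶ Y`, which is zero. -/
lemma exists_embedding_map_eq (hS : S.R0star) {X Y : E}
    (α : (embedding S).obj X ⟶ (embedding S).obj Y) : ∃ f : X ⟶ Y, (embedding S).map f = α := by
  let L := (acyclicComplexes S).trW.Q
  obtain ⟨W, w, β, ⟨K, k, hk⟩, h⟩ := exists_deflation_Q_map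
    (show L.obj (stalk.obj X) ⟶ L.obj (stalk.obj Y) from α.hom)
  obtain ⟨β, rfl⟩ := stalk_map_surjective β
  have h' : (embedding S).map w ≫ α = (embedding S).map β := by
    ext
    exact h
  have hkβ : k ≫ β = 0 := eq_zero_of_embedding_map_eq_zero (S := S) _ (by
    rw [Functor.map_comp, ← h', ← Category.assoc, ← Functor.map_comp, S.zero hk, Functor.map_zero,
      zero_comp])
  obtain ⟨f, hf⟩ := hk.exists_desc β hkβ
  refine ⟨f, ?_⟩
  obtain ⟨δ, hδ⟩ := isTrianglePair_embedding hS hk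
  obtain ⟨ε, hε⟩ := exists_desc₃ hδ (α - (embedding S).map f) (by
    rw [Preadditive.comp_sub, h', ← Functor.map_comp, hf, sub_self])
  rw [shift_embedding_hom_eq_zero hS ε, comp_zero, sub_eq_zero] at hε
  exact hε.symm

lemma isNonnegativeEmbedding_embedding (hS : S.R0star) :
    IsNonnegativeEmbedding (embedding S) where
  full := ⟨fun α => exists_embedding_map_eq hS α⟩
  faithful := ⟨fun {X Y f g} h => sub_eq_zero.1 (eq_zero_of_embedding_map_eq_zero (S := S) _ (by
    rw [Functor.map_sub, h, sub_self]))⟩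
  additive := inferInstance
  neg := shift_embedding_hom_eq_zero hS

lemma isConflation_iff_of_R3 (h : S.R3) {X Y Z : E} (f : X ⟶ Y) (g : Y ⟶ Z) :
    S.IsConflation f g ↔ IsTrianglePair ((embedding S).map f) ((embedding S).map g) :=
  have hS := ConflationStructure.R0star_of_R3 h
  ⟨isTrianglePair_embedding hS, (isNonnegativeEmbedding_embedding hS).isConflation_of_R3
    isEffaceable_embedding h⟩

end Embedding

end RightExactCategory

theorem mainTheorem8 {E : Type u} [Category.{v} E] [Preadditive E] [HasZeroObject E]
    [HasBinaryBiproducts E] (S : RightExactCategory.ConflationStructure E) [S.IsRightExact] :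
    -- axiom R3 holds iff the conflations are exactly the sequences that give triangles
    (S.R3 ↔ ∀ (X Y Z : E) (f : X ⟶ Y) (g : Y ⟶ Z), S.IsConflation f g ↔
      RightExactCategory.IsTrianglePair ((RightExactCategory.embedding S).map f)
        ((RightExactCategory.embedding S).map g)) ∧
    (S.R0star →
      -- if `E` is exact, then `i(E)` is extension-closed
      (S.IsExact →
        RightExactCategory.IsExtensionClosed (RightExactCategory.embedding S).essImage) ∧
      (RightExactCategory.IsExtensionClosed (RightExactCategory.embedding S).essImage →
        -- the triangles with terms in `i(E)` form an exact structure for which `E ⥤ i(E)` is exact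
        (∃ T : RightExactCategory.ConflationStructure (RightExactCategory.Image S),
          (∀ (X Y Z : RightExactCategory.Image S) (f : X ⟶ Y) (g : Y ⟶ Z),
            T.IsConflation f g ↔ RightExactCategory.IsTrianglePair f.hom g.hom) ∧
          T.IsExact ∧
          RightExactCategory.IsExactFunctor S T (RightExactCategory.embedding S).toEssImage) ∧
        -- under axiom R3, `E` itself is exact
        (S.R3 → S.IsExact))) := by
  open RightExactCategory in
  refine ⟨⟨fun h X Y Z f g => isConflation_iff_of_R3 h f g, fun h =>
    (isNonnegativeEmbedding_embedding (R0star_of_isConflation_iff h)).R3_of_isConflation_iff h⟩,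
    fun hS => ?_⟩
  have hF := isNonnegativeEmbedding_embedding hS
  refine ⟨fun h => hF.isExtensionClosed_of_isExact isEffaceable_embedding
    (isTrianglePair_embedding hS) h, fun hext => ⟨?_, fun h => hF.isExact hext S
      fun X Y Z f g => isConflation_iff_of_R3 h f g⟩⟩
  have hι := hF.ι_essImage
  -- To put the exact structure on `i(E)` itself, the general result is applied to its inclusion,
  -- whose essential image is again `i(E)`.
  have hext' : IsExtensionClosed (embedding S).essImage.ι.essImage := by
    rintro X Y Z f g hfg ⟨X', ⟨eX⟩⟩ ⟨Z', ⟨eZ⟩⟩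
    exact ⟨⟨Y, hext f g hfg ((embedding S).essImage.prop_of_iso eX X'.property)
      ((embedding S).essImage.prop_of_iso eZ Z'.property)⟩, ⟨Iso.refl _⟩⟩
  exact ⟨hι.conflationStructure, fun _ _ _ _ _ => Iff.rfl,
    hι.isExact hext' _ fun _ _ _ _ _ => Iff.rfl,
    ⟨⟨fun {_ _ _ _} => by ext : 1; exact (embedding S).map_add⟩,
      fun h => isTrianglePair_embedding hS h⟩⟩
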